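/- Let $?:[0,1]\to[0,1]$ be the Minkowski question mark function: $?(0)=0$, $?(1)=1$, $?\left(\frac{p+p'}{q+q'}\right)=\frac12\left(?\left(\frac pq\right)+?\left(\frac{p'}{q'}\right)\right)$ for consecutive fractions $\frac pq,\frac{p'}{q'}$ of each Stern–Brocot sequence $F_n$ (where $F_0=\{\frac01,\frac11\}$ and $F_{n+1}$ is obtained from $F_n$ by inserting the mediants of all pairs of consecutive elements), extended to irrational points by continuity. For an irrational $x=[0;a_1,a_2,\dots]\in(0,1)$, written as a regular continued fraction, put $S_x(t)=a_1+\dots+a_t$. Let $\lambda_j=\frac{j+\sqrt{j^2+4}}2$ and $$\kappa_2=\frac{4\log\lambda_5-5\log\lambda_4}{\log\lambda_5-\log\lambda_4-\log\sqrt2}\qquad(\text{numerically }4.401\ldots).$$ Theorem 3. (i) Let $x\in(0,1)$ be irrational and suppose that there is a constant $C$ such that $S_x(t)\ge\kappa_2t-C$ for all integers $t\ge1$. Then $?'(x)$ exists and $?'(x)=0$. (ii) Let $\psi$ be a real function on the positive integers that is increasing (not necessarily strictly) and satisfies $\lim_{t\to+\infty}\psi(t)=+\infty$. Then there exists an irrational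 $x\in(0,1)$ such that $?'(x)$ does not exist, neither as a finite nor as an infinite derivative (that is, $\frac{?(y)-?(x)}{y-x}$ has no limit in $[-\infty,+\infty]$ as $y\to x$), and $S_x(t)\ge\kappa_2t-\psi(t)$ for all integers $t\ge1$. -/

import Mathlib

open Filter Topology

noncomputable section

/-- The mediant `(a + c) / (b + d)` of the fractions `a / b` and `c / d`, on pairs
(numerator, denominator). -/
def mediant (u v : ℕ × ℕ) : ℕ × ℕ := (u.1 + v.1, u.2 + v.2)

/-- The Stern–Brocot sequences on `[0, 1]`: `sternBrocot n j`, for `j = 0, …, 2 ^ n`, is the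
`j`-th element of the set `F_n` in increasing order, as a pair (numerator, denominator).
`F_0 = {0/1, 1/1}`, and `F_{n+1}` is `F_n` together with the mediants of all pairs of
consecutive elements of `F_n`. -/
def sternBrocot : ℕ → ℕ → ℕ × ℕ
  | 0, j => if j = 0 then (0, 1) else (1, 1)
  | n + 1, j =>
      if j % 2 = 0 then sternBrocot n (j / 2)
      else mediant (sternBrocot n (j / 2)) (sternBrocot n (j / 2 + 1))

/-- The value of the Minkowski function at the `j`-th element of `F_n`: `?(0) = 0`, `?(1) = 1`, and
the value at the mediant of two consecutive fractions is the mean of the values at these two. -/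
def questionMarkValue : ℕ → ℕ → ℝ
  | 0, j => if j = 0 then 0 else 1
  | n + 1, j =>
      if j % 2 = 0 then questionMarkValue n (j / 2)
      else (questionMarkValue n (j / 2) + questionMarkValue n (j / 2 + 1)) / 2

/-- The Minkowski question mark function `?(x)`. The values prescribed at the rational points
of `[0, 1]` are increasing there and dense in `[0, 1]`, so their unique continuous extension
to `[0, 1]` is the supremum of the values at the Stern–Brocot fractions not exceeding `x`.
(Outside `[0, 1]` this gives `0` on the left and `1` on the right.) -/
def minkowskiQuestionMark (x : ℝ) : ℝ :=
  sSup {y : ℝ | ∃ n j : ℕ, j ≤ 2 ^ n ∧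
    ((sternBrocot n j).1 : ℝ) / ((sternBrocot n j).2 : ℝ) ≤ x ∧ y = questionMarkValue n j}

/-- The partial quotient `a_{i+1}` of the regular continued fraction
`x = [0; a_1, a_2, …]` of an irrational `x ∈ (0, 1)`. (The default `0` is only used when
the expansion terminates, that is, for rational `x`.) -/
def partialQuotient (x : ℝ) (i : ℕ) : ℝ := ((GenContFract.of x).partDens.get? i).getD 0

/-- `S_x(t) = a_1 + a_2 + ⋯ + a_t`. -/
def partialQuotientSum (x : ℝ) (t : ℕ) : ℝ := ∑ i ∈ Finset.range t, partialQuotient x i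

/-- `λ_j = (j + √(j² + 4)) / 2`. -/
def lambdaConst (j : ℕ) : ℝ := ((j : ℝ) + Real.sqrt ((j : ℝ) ^ 2 + 4)) / 2

/-- `κ₂ = (4 log λ₅ - 5 log λ₄) / (log λ₅ - log λ₄ - log √2)`. -/
def kappaTwo : ℝ :=
  (4 * Real.log (lambdaConst 5) - 5 * Real.log (lambdaConst 4)) /
    (Real.log (lambdaConst 5) - Real.log (lambdaConst 4) - Real.log (Real.sqrt 2))

/-- `f` has a derivative at `x`, finite or infinite: the difference quotients
`(f y - f x) / (y - x)` have a limit in `[-∞, +∞]` as `y → x`, `y ≠ x`. -/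
def HasFiniteOrInfiniteDerivAt (f : ℝ → ℝ) (x : ℝ) : Prop :=
  ∃ L : EReal, Tendsto (fun y : ℝ => (((f y - f x) / (y - x) : ℝ) : EReal)) (𝓝[≠] x) (𝓝 L)

end

/-! A Stern–Brocot interval of level n with endpoint denominators q, q' has length 1/(qq') and
`?`-increment 2⁻ⁿ, so `?` has slope qq'/2ⁿ over it. Derivatives at x are read off from the intervals
around x: (q + q')²/2ⁿ → 0 forces `?'(x) = 0` (`hasDerivAt_zero_of_forall_level`), and slopes that
are infinitely often ≥ 1 and infinitely often ≤ 1/2 exclude any derivative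
(`not_hasFiniteOrInfiniteDerivAt`). By `IsContFracTails.exists_adj` the endpoints are convergents
and intermediate fractions of x, and the level is a digit sum minus one; so everything reduces to
comparing q_t² with 2^{S_x(t)}.

A digit j multiplies the vector of two consecutive denominators by the symmetric matrix ((j, 1), (1,
0)), of norm λ_j. Let μ_j = λ₄(λ₅/λ₄)^{j-4}, the geometric progression through λ₄ and λ₅. Then λ_j ≤
μ_j, with a uniform loss when j is not 4 or 5. The constant κ₂ is the real j at which μ_j² = 2^j, so
that ∏ μ_{a_i}² / 2^{S_t} = exp(2D(κ₂t - S_t)) with D = log(√2 λ₄/λ₅) > 0.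

For (i), the hypothesis bounds this exponential, and it remains to gain a factor tending to 0. A
factor below 1 is gained at each digit outside {4, 5} and at each change between 4 and 5, because
the two matrices have different leading eigenvectors. If this happens only finitely often, the
digits are eventually constant: 4 contradicts the hypothesis since κ₂ > 4, and with 5 the
exponential itself tends to 0 since κ₂ < 5 (`tendsto_denNormSq_div`).

For (ii), a long block of 5s makes the slope small because λ₅² < 2⁵, and a following block of 4s
makes it large again because λ₄² > 2⁴. Only one change of digit occurs inside the block, so the
deficit κ₂t - S_t needed for the return is bounded in terms of the earlier digits alone; a long
enough block of 5s lets ψ exceed it (`exists_extension`). Iterating gives x. -/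

/-! ### Stern–Brocot sequences and the values of `?` on them. -/

lemma sternBrocot_even (n j : ℕ) : sternBrocot (n + 1) (2 * j) = sternBrocot n j := by
  simp [sternBrocot]

lemma sternBrocot_odd (n j : ℕ) :
    sternBrocot (n + 1) (2 * j + 1) = sternBrocot n j + sternBrocot n (j + 1) := by
  have h : (2 * j + 1) / 2 = j := by omega
  simp [sternBrocot, h, mediant, Nat.add_mod, Prod.ext_iff]

lemma sternBrocot_den_pos (n j : ℕ) : 1 ≤ (sternBrocot n j).2 := by
  induction n generalizing j with
  | zero => simp only [sternBrocot]; split <;> simp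
  | succ n ih =>
    rcases Nat.even_or_odd' j with ⟨i, rfl | rfl⟩
    · rw [sternBrocot_even]; exact ih i
    · rw [sternBrocot_odd]
      have := ih i
      simp only [Prod.snd_add]; omega

lemma sternBrocot_det (n j : ℕ) (hj : j < 2 ^ n) :
    (sternBrocot n (j + 1)).1 * (sternBrocot n j).2 =
      (sternBrocot n j).1 * (sternBrocot n (j + 1)).2 + 1 := by
  induction n generalizing j with
  | zero =>
    obtain rfl : j = 0 := by simpa using hj
    simp [sternBrocot]
  | succ n ih =>
    rw [pow_succ] at hj
    rcases Nat.even_or_odd' j with ⟨i, rfl | rfl⟩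
    · have := ih i (by omega)
      rw [sternBrocot_even, sternBrocot_odd]
      simp only [Prod.snd_add, Prod.fst_add]
      linarith
    · have := ih i (by omega)
      rw [show 2 * i + 1 + 1 = 2 * (i + 1) by ring, sternBrocot_even, sternBrocot_odd]
      simp only [Prod.snd_add, Prod.fst_add]
      linarith

lemma sternBrocot_den_add (n j : ℕ) :
    n + 2 ≤ (sternBrocot n j).2 + (sternBrocot n (j + 1)).2 := by
  induction n generalizing j with
  | zero =>
    have h1 := sternBrocot_den_pos 0 j
    have h2 := sternBrocot_den_pos 0 (j + 1)
    omega
  | succ n ih =>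
    rcases Nat.even_or_odd' j with ⟨i, rfl | rfl⟩
    · have := ih i
      have h1 := sternBrocot_den_pos n i
      rw [sternBrocot_even, sternBrocot_odd]
      simp only [Prod.snd_add]
      omega
    · have := ih i
      have h1 := sternBrocot_den_pos n (i + 1)
      rw [show 2 * i + 1 + 1 = 2 * (i + 1) by ring, sternBrocot_even, sternBrocot_odd]
      simp only [Prod.snd_add]
      omega

lemma sternBrocot_pow_mul (n k j : ℕ) : sternBrocot (n + k) (2 ^ k * j) = sternBrocot n j := by
  induction k with
  | zero => simp
  | succ k ih =>
    rw [← add_assoc, show 2 ^ (k + 1) * j = 2 * (2 ^ k * j) by ring, sternBrocot_even, ih]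

lemma questionMarkValue_eq (n j : ℕ) (hj : j ≤ 2 ^ n) :
    questionMarkValue n j = (j : ℝ) / 2 ^ n := by
  induction n generalizing j with
  | zero =>
    have : j = 0 ∨ j = 1 := by
      rw [pow_zero] at hj; omega
    rcases this with rfl | rfl <;> simp [questionMarkValue]
  | succ n ih =>
    rw [pow_succ] at hj
    rcases Nat.even_or_odd' j with ⟨i, rfl | rfl⟩
    · have : questionMarkValue (n + 1) (2 * i) = questionMarkValue n i := by
        simp [questionMarkValue]
      rw [this, ih i (by omega)]
      push_cast
      rw [pow_succ]
      field_simp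
    · have h : (2 * i + 1) / 2 = i := by omega
      have : questionMarkValue (n + 1) (2 * i + 1) =
          (questionMarkValue n i + questionMarkValue n (i + 1)) / 2 := by
        simp [questionMarkValue, h, Nat.add_mod]
      rw [this, ih i (by omega), ih (i + 1) (by omega)]
      push_cast
      field_simp
      ring

/-- The value of the fraction represented by a pair (numerator, denominator). -/
noncomputable def fracVal (u : ℕ × ℕ) : ℝ := (u.1 : ℝ) / (u.2 : ℝ)

lemma fracVal_nonneg (u : ℕ × ℕ) : 0 ≤ fracVal u := by unfold fracVal; positivity

lemma fracVal_sternBrocot_succ_sub (n j : ℕ) (hj : j < 2 ^ n) :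
    fracVal (sternBrocot n (j + 1)) - fracVal (sternBrocot n j) =
      1 / ((sternBrocot n j).2 * (sternBrocot n (j + 1)).2 : ℝ) := by
  have h1 : (0 : ℝ) < (sternBrocot n j).2 := by exact_mod_cast sternBrocot_den_pos n j
  have h2 : (0 : ℝ) < (sternBrocot n (j + 1)).2 := by
    exact_mod_cast sternBrocot_den_pos n (j + 1)
  have h3 : ((sternBrocot n (j + 1)).1 : ℝ) * (sternBrocot n j).2 =
      (sternBrocot n j).1 * (sternBrocot n (j + 1)).2 + 1 := by
    exact_mod_cast sternBrocot_det n j hj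
  unfold fracVal
  field_simp
  linarith

lemma fracVal_sternBrocot_strictMonoOn (n : ℕ) :
    StrictMonoOn (fun j => fracVal (sternBrocot n j)) (Set.Iic (2 ^ n)) := by
  have key : ∀ d i : ℕ, i + d + 1 ≤ 2 ^ n →
      fracVal (sternBrocot n i) < fracVal (sternBrocot n (i + d + 1)) := by
    have step : ∀ i : ℕ, i < 2 ^ n →
        fracVal (sternBrocot n i) < fracVal (sternBrocot n (i + 1)) := by
      intro i hi
      have h := fracVal_sternBrocot_succ_sub n i hi
      have h1 : (0 : ℝ) < (sternBrocot n i).2 := by exact_mod_cast sternBrocot_den_pos n i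
      have h2 : (0 : ℝ) < (sternBrocot n (i + 1)).2 := by
        exact_mod_cast sternBrocot_den_pos n (i + 1)
      have : (0 : ℝ) < 1 / ((sternBrocot n i).2 * (sternBrocot n (i + 1)).2 : ℝ) := by
        positivity
      linarith
    intro d
    induction d with
    | zero => intro i hi; exact step i (by omega)
    | succ d ih =>
      intro i hi
      exact (ih i (by omega)).trans (step (i + d + 1) (by omega))
  intro i hi j hj hij
  obtain ⟨d, rfl⟩ := Nat.exists_eq_add_of_lt hij
  exact key d i hj

/-- Both fractions also occur at level `n + n'`, where the order of fractions is the order of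
indices. -/
lemma div_pow_le_of_fracVal_le {n j n' j' : ℕ} (hj : j ≤ 2 ^ n) (hj' : j' ≤ 2 ^ n')
    (h : fracVal (sternBrocot n' j') ≤ fracVal (sternBrocot n j)) :
    (j' : ℝ) / 2 ^ n' ≤ (j : ℝ) / 2 ^ n := by
  rw [← sternBrocot_pow_mul n n' j, ← sternBrocot_pow_mul n' n j', add_comm n' n] at h
  have h1 : 2 ^ n' * j ∈ Set.Iic (2 ^ (n + n')) := by
    rw [Set.mem_Iic, pow_add, mul_comm]; gcongr
  have h2 : 2 ^ n * j' ∈ Set.Iic (2 ^ (n + n')) := by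
    rw [Set.mem_Iic, pow_add]; gcongr
  have h3 := ((fracVal_sternBrocot_strictMonoOn (n + n')).le_iff_le h2 h1).1 h
  have h4 : (2 : ℝ) ^ n * j' ≤ 2 ^ n' * j := by exact_mod_cast h3
  rw [div_le_div_iff₀ (by positivity) (by positivity)]
  linarith

lemma minkowskiQuestionMark_le {x : ℝ} (hx : 0 ≤ x) {n j : ℕ} (hj : j ≤ 2 ^ n)
    (h : x ≤ fracVal (sternBrocot n j)) : minkowskiQuestionMark x ≤ (j : ℝ) / 2 ^ n := by
  unfold minkowskiQuestionMark
  apply csSup_le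
  · exact ⟨_, 0, 0, by simp, by simpa [sternBrocot] using hx, rfl⟩
  · rintro y ⟨n', j', hj', hle, rfl⟩
    rw [questionMarkValue_eq n' j' hj']
    exact div_pow_le_of_fracVal_le hj hj' (le_trans hle h)

lemma le_minkowskiQuestionMark {x : ℝ} {n j : ℕ} (hj : j ≤ 2 ^ n)
    (h : fracVal (sternBrocot n j) ≤ x) : (j : ℝ) / 2 ^ n ≤ minkowskiQuestionMark x := by
  unfold minkowskiQuestionMark
  apply le_csSup
  · refine ⟨1, ?_⟩
    rintro y ⟨n', j', hj', hle, rfl⟩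
    rw [questionMarkValue_eq n' j' hj', div_le_one (by positivity)]
    exact_mod_cast hj'
  · exact ⟨n, j, hj, h, (questionMarkValue_eq n j hj).symm⟩

/-! ### Oriented Stern–Brocot intervals and local Lipschitz bounds. -/

/-- `u` and `v` are consecutive elements of `F_n`, with `u` the smaller one if `s = 1` and
the larger one if `s = -1`. -/
def SBAdj (s : ℤ) (n : ℕ) (u v : ℕ × ℕ) : Prop :=
  ∃ j : ℕ, j < 2 ^ n ∧ ((s = 1 ∧ sternBrocot n j = u ∧ sternBrocot n (j + 1) = v) ∨
    (s = -1 ∧ sternBrocot n j = v ∧ sternBrocot n (j + 1) = u))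

namespace SBAdj

variable {s : ℤ} {n : ℕ} {u v : ℕ × ℕ}

lemma symm (h : SBAdj s n u v) : SBAdj (-s) n v u := by
  obtain ⟨j, hj, ⟨rfl, h1, h2⟩ | ⟨rfl, h1, h2⟩⟩ := h
  · exact ⟨j, hj, Or.inr ⟨rfl, h1, h2⟩⟩
  · exact ⟨j, hj, Or.inl ⟨by norm_num, h1, h2⟩⟩

lemma left (h : SBAdj s n u v) : SBAdj s (n + 1) u (v + u) := by
  obtain ⟨j, hj, ⟨rfl, rfl, rfl⟩ | ⟨rfl, rfl, rfl⟩⟩ := h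
  · exact ⟨2 * j, by rw [pow_succ]; omega, Or.inl ⟨rfl, sternBrocot_even n j, by
      rw [sternBrocot_odd, add_comm]⟩⟩
  · exact ⟨2 * j + 1, by rw [pow_succ]; omega, Or.inr ⟨rfl, sternBrocot_odd n j, by
      rw [show 2 * j + 1 + 1 = 2 * (j + 1) by ring, sternBrocot_even]⟩⟩

lemma right (h : SBAdj s n u v) : SBAdj s (n + 1) (v + u) v := by
  have := h.symm.left.symm
  rwa [neg_neg, add_comm u v] at this

lemma iterate (h : SBAdj s n u v) (k : ℕ) : SBAdj s (n + k) u (v + k • u) := by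
  induction k with
  | zero => simpa using h
  | succ k ih =>
    have := ih.left
    rwa [add_assoc v, ← succ_nsmul] at this

lemma sign (h : SBAdj s n u v) : s = 1 ∨ s = -1 := by
  obtain ⟨j, hj, ⟨rfl, -, -⟩ | ⟨rfl, -, -⟩⟩ := h <;> simp

lemma left_den_pos (h : SBAdj s n u v) : 1 ≤ u.2 := by
  obtain ⟨j, hj, ⟨rfl, rfl, rfl⟩ | ⟨rfl, rfl, rfl⟩⟩ := h <;> apply sternBrocot_den_pos

lemma right_den_pos (h : SBAdj s n u v) : 1 ≤ v.2 := h.symm.left_den_pos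

lemma den_add (h : SBAdj s n u v) : n + 2 ≤ u.2 + v.2 := by
  obtain ⟨j, hj, ⟨rfl, rfl, rfl⟩ | ⟨rfl, rfl, rfl⟩⟩ := h
  · apply sternBrocot_den_add
  · rw [add_comm (Prod.snd _)]; apply sternBrocot_den_add

lemma sub_eq (h : SBAdj s n u v) : s * (fracVal v - fracVal u) = 1 / (u.2 * v.2 : ℝ) := by
  obtain ⟨j, hj, ⟨rfl, rfl, rfl⟩ | ⟨rfl, rfl, rfl⟩⟩ := h
  · rw [Int.cast_one, one_mul, fracVal_sternBrocot_succ_sub n j hj]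
  · rw [mul_comm (Nat.cast _ : ℝ), ← fracVal_sternBrocot_succ_sub n j hj]
    push_cast; ring

lemma length_le (h : SBAdj s n u v) : s * (fracVal v - fracVal u) ≤ 1 / (n + 1 : ℝ) := by
  rw [h.sub_eq]
  have h1 := h.left_den_pos
  have h2 := h.right_den_pos
  have h3 := h.den_add
  -- From (q - 1)(q' - 1) ≥ 0 and q + q' ≥ n + 2.
  have : n + 1 ≤ u.2 * v.2 := by
    obtain ⟨c, hc⟩ := Nat.exists_eq_add_of_le h1
    obtain ⟨d, hd⟩ := Nat.exists_eq_add_of_le h2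
    rw [hc, hd] at h3 ⊢
    nlinarith [Nat.zero_le (c * d)]
  apply one_div_le_one_div_of_le (by positivity)
  exact_mod_cast this

lemma abs_sub_left_le (h : SBAdj s n u v) {y : ℝ} (h1 : 0 ≤ s * (y - fracVal u))
    (h2 : 0 ≤ s * (fracVal v - y)) :
    |minkowskiQuestionMark y - minkowskiQuestionMark (fracVal u)| ≤ 1 / 2 ^ n := by
  obtain ⟨j, hj, ⟨rfl, rfl, rfl⟩ | ⟨rfl, rfl, rfl⟩⟩ := h
  · have h0 := fracVal_nonneg (sternBrocot n j)
    push_cast at h1 h2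
    have a1 := le_minkowskiQuestionMark hj.le (show fracVal (sternBrocot n j) ≤ y by linarith)
    have a2 := minkowskiQuestionMark_le (x := y) (by linarith) (show j + 1 ≤ 2 ^ n from hj)
      (by linarith)
    have a3 := le_minkowskiQuestionMark hj.le (le_refl (fracVal (sternBrocot n j)))
    have a4 := minkowskiQuestionMark_le h0 hj.le le_rfl
    push_cast at a2
    rw [add_div] at a2
    rw [abs_le]; constructor <;> linarith [show (0:ℝ) < 1 / 2 ^ n by positivity]
  · have h0 := fracVal_nonneg (sternBrocot n j)
    have h0' := fracVal_nonneg (sternBrocot n (j + 1))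
    push_cast at h1 h2
    have a1 := le_minkowskiQuestionMark hj.le (show fracVal (sternBrocot n j) ≤ y by linarith)
    have a2 := minkowskiQuestionMark_le (x := y) (by linarith) (show j + 1 ≤ 2 ^ n from hj)
      (by linarith)
    have a3 := le_minkowskiQuestionMark (show j + 1 ≤ 2 ^ n from hj) le_rfl
    have a4 := minkowskiQuestionMark_le h0' (show j + 1 ≤ 2 ^ n from hj) le_rfl
    push_cast at a2 a3 a4
    rw [add_div] at a2 a3 a4
    rw [abs_le]; constructor <;> linarith [show (0:ℝ) < 1 / 2 ^ n by positivity]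

lemma questionMark_sub (h : SBAdj s n u v) :
    s * (minkowskiQuestionMark (fracVal v) - minkowskiQuestionMark (fracVal u)) = 1 / 2 ^ n := by
  have key : ∀ j ≤ 2 ^ n, minkowskiQuestionMark (fracVal (sternBrocot n j)) = (j : ℝ) / 2 ^ n :=
    fun j hj => le_antisymm (minkowskiQuestionMark_le (fracVal_nonneg _) hj le_rfl)
      (le_minkowskiQuestionMark hj le_rfl)
  obtain ⟨j, hj, ⟨rfl, rfl, rfl⟩ | ⟨rfl, rfl, rfl⟩⟩ := h <;>
  · rw [key j hj.le, key (j + 1) hj]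
    push_cast; ring

/-- One-sided Lipschitz bound for `?` at a Stern–Brocot fraction. -/
lemma abs_sub_left_le_mul (h : SBAdj s n u v) (hvu : v.2 ≤ u.2) {y : ℝ}
    (h1 : 0 ≤ s * (y - fracVal u)) (h2 : 0 ≤ s * (fracVal v - y)) :
    |minkowskiQuestionMark y - minkowskiQuestionMark (fracVal u)| ≤
      2 * (u.2 : ℝ) ^ 2 / 2 ^ n * |y - fracVal u| := by
  have hss : (s : ℝ) = 1 ∨ (s : ℝ) = -1 := by
    rcases h.sign with rfl | rfl <;> simp
  have habs : |y - fracVal u| = s * (y - fracVal u) := by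
    rw [← abs_of_nonneg h1, abs_mul]
    rcases hss with h | h <;> simp [h]
  set τ := s * (y - fracVal u) with hτ
  rcases h1.eq_or_lt with h0 | h0
  · have : y = fracVal u := by
      rw [← h0, abs_eq_zero] at habs; linarith
    rw [this]; simp
  have hu : (1 : ℝ) ≤ u.2 := by exact_mod_cast h.left_den_pos
  have hv : (1 : ℝ) ≤ v.2 := by exact_mod_cast h.right_den_pos
  have hvu' : (v.2 : ℝ) ≤ u.2 := by exact_mod_cast hvu
  -- The fractions `v + k • u` converge to `u`. The least such k puts y between `u` and `v + k • u`,
  -- an interval of level n + k, but beyond `v + (k + 1) • u`. So the `?`-increment is at most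
  -- 2^{-(n+k)} while the distance exceeds 1/(q(q' + (k + 1)q)); the constant 2 comes from k + 2 ≤ 2
  -- · 2ᵏ.
  have hex : ∃ k : ℕ, 1 / ((u.2 : ℝ) * (v.2 + (k + 1) * u.2)) < τ := by
    obtain ⟨k, hk⟩ := exists_nat_one_div_lt h0
    refine ⟨k, lt_of_le_of_lt ?_ hk⟩
    apply one_div_le_one_div_of_le (by positivity)
    have : (k + 1 : ℝ) * 1 ≤ (k + 1) * u.2 := by gcongr
    nlinarith
  classical
  set k := Nat.find hex with hk
  have hk1 := Nat.find_spec hex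
  rw [← hk] at hk1
  have hk2 : τ ≤ 1 / ((u.2 : ℝ) * (v.2 + k * u.2)) := by
    rcases Nat.eq_zero_or_pos k with h3 | h3
    · rw [h3, Nat.cast_zero, zero_mul, add_zero, ← h.sub_eq]
      linarith
    · have := Nat.find_min hex (show k - 1 < k by omega)
      rw [not_lt] at this
      have e : ((k - 1 : ℕ) : ℝ) + 1 = k := by
        exact_mod_cast Nat.sub_add_cancel h3
      rwa [e] at this
  have hadj := h.iterate k
  have hsub := hadj.sub_eq
  have e2 : ((v + k • u).2 : ℝ) = v.2 + k * u.2 := by simp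
  rw [e2] at hsub
  have hb := hadj.abs_sub_left_le (y := y) h1 (by linarith)
  rw [habs]
  refine hb.trans ?_
  rw [div_lt_iff₀ (by positivity)] at hk1
  have hk3 : (k : ℝ) + 2 ≤ 2 * 2 ^ k := by
    have : k + 2 ≤ 2 * 2 ^ k := by
      have := Nat.lt_two_pow_self (n := k)
      omega
    exact_mod_cast this
  have hk4 : (1 : ℝ) ≤ τ * (u.2 ^ 2 * (2 * 2 ^ k)) := by
    have hk5 : (v.2 : ℝ) + (k + 1) * u.2 ≤ u.2 * (2 * 2 ^ k) := by nlinarith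
    refine hk1.le.trans (mul_le_mul_of_nonneg_left ?_ h0.le)
    calc (u.2 : ℝ) * (v.2 + (k + 1) * u.2) ≤ u.2 * (u.2 * (2 * 2 ^ k)) := by gcongr
      _ = u.2 ^ 2 * (2 * 2 ^ k) := by ring
  rw [pow_add, div_mul_eq_mul_div, div_le_div_iff₀ (by positivity) (by positivity)]
  have : (0:ℝ) < 2 ^ n := by positivity
  nlinarith

/-- `?` is Lipschitz across the mediant of two consecutive fractions. -/
lemma abs_sub_le_of_mediant (h : SBAdj s n u v) {x y : ℝ}
    (hx1 : 0 ≤ s * (x - fracVal u)) (hx2 : 0 ≤ s * (fracVal (v + u) - x))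
    (hy1 : 0 ≤ s * (y - fracVal (v + u))) (hy2 : 0 ≤ s * (fracVal v - y)) :
    |minkowskiQuestionMark y - minkowskiQuestionMark x| ≤
      ((u.2 : ℝ) + v.2) ^ 2 / 2 ^ n * |y - x| := by
  have hss : (s : ℝ) = 1 ∨ (s : ℝ) = -1 := by
    rcases h.sign with rfl | rfl <;> simp
  -- The mediant separates x and y, and its denominator dominates both others, so the one-sided
  -- bound applies at the mediant in both directions; the two distances add up to |y - x|.
  have a1 := h.right.abs_sub_left_le_mul (y := y) (by simp) hy1 hy2
  have a2 := h.left.symm.abs_sub_left_le_mul (y := x) (by simp) (by push_cast; linarith)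
    (by push_cast; linarith)
  set m := fracVal (v + u)
  have e : |y - x| = |y - m| + |x - m| := by
    rcases hss with hs | hs <;> rw [hs] at hx2 hy1
    · rw [abs_of_nonneg (by linarith), abs_of_nonneg (by linarith), abs_of_nonpos (by linarith)]
      ring
    · rw [abs_of_nonpos (by linarith), abs_of_nonpos (by linarith), abs_of_nonneg (by linarith)]
      ring
  have e2 : 2 * (((v + u).2 : ℕ) : ℝ) ^ 2 / 2 ^ (n + 1) = ((u.2 : ℝ) + v.2) ^ 2 / 2 ^ n := by
    rw [pow_succ]; push_cast [Prod.snd_add]; field_simp; ring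
  rw [e2] at a1 a2
  rw [e, mul_add]
  have := abs_sub_le (minkowskiQuestionMark y) (minkowskiQuestionMark m) (minkowskiQuestionMark x)
  rw [abs_sub_comm (minkowskiQuestionMark m)] at this
  linarith

/-- Only one interval of level n contains x in its interior. Its two orientations swap the
endpoints, so a symmetric function of the denominators is what is determined. -/
lemma den_add_unique {s' : ℤ} {u' v' : ℕ × ℕ} (h : SBAdj s n u v) (h' : SBAdj s' n u' v') {x : ℝ}
    (h1 : 0 < s * (x - fracVal u)) (h2 : 0 < s * (fracVal v - x))
    (h1' : 0 < s' * (x - fracVal u')) (h2' : 0 < s' * (fracVal v' - x)) :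
    u.2 + v.2 = u'.2 + v'.2 := by
  have key : ∀ i j : ℕ, i < 2 ^ n → j < 2 ^ n → fracVal (sternBrocot n i) < x →
      x < fracVal (sternBrocot n (j + 1)) → i ≤ j := by
    intro i j hi hj h3 h4
    have := (fracVal_sternBrocot_strictMonoOn n).lt_iff_lt (Set.mem_Iic.2 hi.le)
      (Set.mem_Iic.2 (show j + 1 ≤ 2 ^ n from hj))
    exact Nat.lt_succ_iff.1 (this.1 (h3.trans h4))
  obtain ⟨j, hj, ⟨rfl, rfl, rfl⟩ | ⟨rfl, rfl, rfl⟩⟩ := h <;>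
  obtain ⟨j', hj', ⟨rfl, rfl, rfl⟩ | ⟨rfl, rfl, rfl⟩⟩ := h' <;> push_cast at * <;>
  · have : j = j' := le_antisymm (key j j' hj hj' (by linarith) (by linarith))
      (key j' j hj' hj (by linarith) (by linarith))
    subst this; omega

end SBAdj

/-! ### Differentiability criteria in terms of the intervals around x. -/

lemma irrational_ne_fracVal {x : ℝ} (hx : Irrational x) (u : ℕ × ℕ) : x ≠ fracVal u := by
  intro h
  apply hx
  exact ⟨(u.1 : ℚ) / u.2, by rw [h]; simp [fracVal]⟩

/-- Descend through the intervals containing both x and y until a mediant separates them; there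
`SBAdj.abs_sub_le_of_mediant` applies. -/
lemma abs_sub_le_of_forall_level {x ε : ℝ} (hx : Irrational x) {N : ℕ}
    (hε : ∀ n ≥ N, ∀ s u v, SBAdj s n u v → 0 < s * (x - fracVal u) →
      0 < s * (fracVal v - x) → ((u.2 : ℝ) + v.2) ^ 2 / 2 ^ n ≤ ε)
    {s : ℤ} {n : ℕ} {u v : ℕ × ℕ} (hn : N ≤ n) (h : SBAdj s n u v)
    (hx1 : 0 < s * (x - fracVal u)) (hx2 : 0 < s * (fracVal v - x)) {y : ℝ}
    (hy1 : 0 ≤ s * (y - fracVal u)) (hy2 : 0 ≤ s * (fracVal v - y)) :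
    |minkowskiQuestionMark y - minkowskiQuestionMark x| ≤ ε * |y - x| := by
  rcases eq_or_ne y x with rfl | hne
  · simp
  have hpos : 0 < |y - x| := abs_pos.2 (sub_ne_zero.2 hne)
  obtain ⟨K, hK⟩ := exists_nat_one_div_lt hpos
  -- `d` bounds the remaining descents: from level `K` on, intervals are shorter than |y - x|.
  have main : ∀ d n : ℕ, N ≤ n → K ≤ n + d → ∀ (s : ℤ) u v, SBAdj s n u v →
      0 < s * (x - fracVal u) →
      0 < s * (fracVal v - x) → 0 ≤ s * (y - fracVal u) → 0 ≤ s * (fracVal v - y) →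
      |minkowskiQuestionMark y - minkowskiQuestionMark x| ≤ ε * |y - x| := by
    intro d
    induction d with
    | zero =>
      intro n hn hKn s u v h hx1 hx2 hy1 hy2
      exfalso
      have h3 := h.length_le
      have h4 : 1 / (n + 1 : ℝ) ≤ 1 / (K + 1) := by
        apply one_div_le_one_div_of_le (by positivity)
        have : (K : ℝ) ≤ n := by exact_mod_cast hKn
        linarith
      have h5 : |y - x| ≤ s * (fracVal v - fracVal u) := by
        rcases h.sign with rfl | rfl <;> push_cast at * <;> rw [abs_le] <;>
          constructor <;> linarith
      linarith
    | succ d ih =>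
      intro n hn hKn s u v h hx1 hx2 hy1 hy2
      have hsx : (0 : ℝ) ≤ s * (x - fracVal (v + u)) ∨ 0 ≤ s * (fracVal (v + u) - x) := by
        rcases le_total 0 (s * (x - fracVal (v + u))) with h | h
        · exact Or.inl h
        · right; linarith
      have hsy : (0 : ℝ) ≤ s * (y - fracVal (v + u)) ∨ 0 ≤ s * (fracVal (v + u) - y) := by
        rcases le_total 0 (s * (y - fracVal (v + u))) with h | h
        · exact Or.inl h
        · right; linarith
      have hs0 : (s : ℝ) ≠ 0 := by
        rcases h.sign with rfl | rfl <;> simp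
      have hxm := irrational_ne_fracVal hx (v + u)
      have hM := mul_le_mul_of_nonneg_right (hε n hn s u v h hx1 hx2) hpos.le
      rcases hsx with hsx | hsx <;> rcases hsy with hsy | hsy
      · have : 0 < s * (x - fracVal (v + u)) :=
          lt_of_le_of_ne hsx (mul_ne_zero hs0 (sub_ne_zero.2 hxm)).symm
        exact ih (n + 1) (by omega) (by omega) s _ _ h.right this hx2 hsy hy2
      · have := h.abs_sub_le_of_mediant hy1 hsy hsx hx2.le
        rw [abs_sub_comm, abs_sub_comm x y] at this
        exact this.trans hM
      · exact (h.abs_sub_le_of_mediant hx1.le hsx hsy hy2).trans hM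
      · have : 0 < s * (fracVal (v + u) - x) :=
          lt_of_le_of_ne hsx (mul_ne_zero hs0 (sub_ne_zero.2 hxm.symm)).symm
        exact ih (n + 1) (by omega) (by omega) s _ _ h.left hx1 this hy1 hsy
  exact main K n hn (by omega) s u v h hx1 hx2 hy1 hy2

lemma eventually_pos_mul_sub {s a x : ℝ} (h : 0 < s * (x - a)) :
    ∀ᶠ y in 𝓝 x, 0 < s * (y - a) :=
  (show ContinuousAt (fun y : ℝ => s * (y - a)) x by fun_prop).eventually (lt_mem_nhds h)

/-- If the intervals of the Stern–Brocot sequences around `x` satisfy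
`(q + q')² / 2ⁿ → 0`, then `?'(x) = 0`. -/
lemma hasDerivAt_zero_of_forall_level {x : ℝ} (hx : Irrational x)
    (H : ∀ ε > 0, ∃ N : ℕ, ∀ n ≥ N, ∃ s u v, SBAdj s n u v ∧ 0 < s * (x - fracVal u) ∧
      0 < s * (fracVal v - x) ∧ ((u.2 : ℝ) + v.2) ^ 2 / 2 ^ n ≤ ε) :
    HasDerivAt minkowskiQuestionMark 0 x := by
  rw [hasDerivAt_iff_isLittleO, Asymptotics.isLittleO_iff]
  intro ε hε
  obtain ⟨N, hN⟩ := H ε hε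
  have hall : ∀ n ≥ N, ∀ s u v, SBAdj s n u v → 0 < s * (x - fracVal u) →
      0 < s * (fracVal v - x) → ((u.2 : ℝ) + v.2) ^ 2 / 2 ^ n ≤ ε := by
    intro n hn s u v h h1 h2
    obtain ⟨s', u', v', h', h1', h2', h3'⟩ := hN n hn
    have : ((u.2 : ℝ) + v.2) = u'.2 + v'.2 := by
      exact_mod_cast h.den_add_unique h' h1 h2 h1' h2'
    rwa [this]
  obtain ⟨s, u, v, h, h1, h2, -⟩ := hN N le_rfl
  have e1 := eventually_pos_mul_sub h1
  have e2 := eventually_pos_mul_sub (s := -s) (a := fracVal v) (x := x) (by linarith)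
  filter_upwards [e1, e2] with y hy1 hy2
  simpa using abs_sub_le_of_forall_level hx hall le_rfl h h1 h2 hy1.le (by linarith)

/-- If the slopes of `?` over the Stern–Brocot intervals around `x` are infinitely often at least
`1` and infinitely often at most `1 / 2`, then `?` has no derivative at `x`. -/
lemma not_hasFiniteOrInfiniteDerivAt {x : ℝ}
    (H1 : ∀ N : ℕ, ∃ n ≥ N, ∃ s u v, SBAdj s n u v ∧ 0 < s * (x - fracVal u) ∧
      0 < s * (fracVal v - x) ∧ 1 ≤ (u.2 : ℝ) * v.2 / 2 ^ n)
    (H2 : ∀ N : ℕ, ∃ n ≥ N, ∃ s u v, SBAdj s n u v ∧ 0 < s * (x - fracVal u) ∧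
      0 < s * (fracVal v - x) ∧ (u.2 : ℝ) * v.2 / 2 ^ n ≤ 1 / 2) :
    ¬ HasFiniteOrInfiniteDerivAt minkowskiQuestionMark x := by
  rintro ⟨L, hL⟩
  have near : ∀ δ > 0, ∃ N : ℕ, ∀ n ≥ N, ∀ (s : ℤ) u v, SBAdj s n u v → 0 < s * (x - fracVal u) →
      0 < s * (fracVal v - x) → (fracVal u ≠ x ∧ |fracVal u - x| < δ) ∧
        (fracVal v ≠ x ∧ |fracVal v - x| < δ) := by
    intro δ hδ
    obtain ⟨N, hN⟩ := exists_nat_one_div_lt hδ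
    refine ⟨N, fun n hn s u v h h1 h2 => ?_⟩
    have h3 := h.length_le
    have h4 : 1 / (n + 1 : ℝ) ≤ 1 / (N + 1) := by
      apply one_div_le_one_div_of_le (by positivity)
      have : (N : ℝ) ≤ n := by exact_mod_cast hn
      linarith
    have h5 : fracVal u ≠ x := by rintro rfl; simp at h1
    have h6 : fracVal v ≠ x := by rintro rfl; simp at h2
    refine ⟨⟨h5, ?_⟩, h6, ?_⟩ <;>
    · rcases h.sign with rfl | rfl <;> push_cast at * <;> rw [abs_lt] <;>
        constructor <;> linarith
  set Q : ℝ → ℝ := fun y => (minkowskiQuestionMark y - minkowskiQuestionMark x) / (y - x) with hQ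
  -- The slope over the interval is a mean, with positive weights, of the difference quotients from
  -- x to the two endpoints. So one of these is at least the slope and one at most.
  have slope : ∀ (n : ℕ) (s : ℤ) u v, SBAdj s n u v → 0 < s * (x - fracVal u) →
      0 < s * (fracVal v - x) → ∃ A B : ℝ, 0 < A ∧ 0 < B ∧
      Q (fracVal u) * A + Q (fracVal v) * B = ((u.2 : ℝ) * v.2 / 2 ^ n) * (A + B) := by
    intro n s u v h h1 h2
    have h5 : fracVal u - x ≠ 0 := by
      intro h; rw [← neg_sub, h] at h1; simp at h1
    have h6 : fracVal v - x ≠ 0 := by intro h; rw [h] at h2; simp at h2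
    refine ⟨_, _, h1, h2, ?_⟩
    have e1 : Q (fracVal u) * (s * (x - fracVal u)) =
        s * (minkowskiQuestionMark x - minkowskiQuestionMark (fracVal u)) := by
      simp only [hQ]; field_simp; ring
    have e2 : Q (fracVal v) * (s * (fracVal v - x)) =
        s * (minkowskiQuestionMark (fracVal v) - minkowskiQuestionMark x) := by
      simp only [hQ]; field_simp
    have hu : (0 : ℝ) < u.2 := by exact_mod_cast h.left_den_pos
    have hv : (0 : ℝ) < v.2 := by exact_mod_cast h.right_den_pos
    have e3 : (s : ℝ) * (x - fracVal u) + s * (fracVal v - x) = 1 / (u.2 * v.2) := by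
      rw [← h.sub_eq]; ring
    rw [e1, e2, e3]
    have e4 := h.questionMark_sub
    rw [show (u.2 : ℝ) * v.2 / 2 ^ n * (1 / (u.2 * v.2)) = 1 / 2 ^ n by field_simp, ← e4]
    ring
  have freq : ∀ p : ℝ → Prop, (∀ δ > 0, ∃ y, y ≠ x ∧ |y - x| < δ ∧ p y) →
      ∃ᶠ y in 𝓝[≠] x, p y := by
    intro p hp
    rw [Filter.frequently_iff]
    intro U hU
    rw [Metric.mem_nhdsWithin_iff] at hU
    obtain ⟨δ, hδ, hsub⟩ := hU
    obtain ⟨y, h1, h2, h3⟩ := hp δ hδ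
    exact ⟨y, hsub ⟨by rwa [Metric.mem_ball, Real.dist_eq], h1⟩, h3⟩
  have f1 : ∃ᶠ y in 𝓝[≠] x, (1 : ℝ) ≤ Q y := by
    apply freq
    intro δ hδ
    obtain ⟨N, hN⟩ := near δ hδ
    obtain ⟨n, hn, s, u, v, h, h1, h2, h3⟩ := H1 N
    obtain ⟨⟨a1, a2⟩, b1, b2⟩ := hN n hn s u v h h1 h2
    obtain ⟨A, B, hA, hB, hAB⟩ := slope n s u v h h1 h2
    by_contra! hc
    have c1 := hc _ a1 a2
    have c2 := hc _ b1 b2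
    nlinarith
  have f2 : ∃ᶠ y in 𝓝[≠] x, Q y ≤ (1 / 2 : ℝ) := by
    apply freq
    intro δ hδ
    obtain ⟨N, hN⟩ := near δ hδ
    obtain ⟨n, hn, s, u, v, h, h1, h2, h3⟩ := H2 N
    obtain ⟨⟨a1, a2⟩, b1, b2⟩ := hN n hn s u v h h1 h2
    obtain ⟨A, B, hA, hB, hAB⟩ := slope n s u v h h1 h2
    by_contra! hc
    have c1 := hc _ a1 a2
    have c2 := hc _ b1 b2
    nlinarith
  have g1 : ((1 : ℝ) : EReal) ≤ L :=
    ge_of_tendsto_of_frequently hL (f1.mono fun y hy => EReal.coe_le_coe_iff.2 hy)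
  have g2 : L ≤ ((1 / 2 : ℝ) : EReal) :=
    le_of_tendsto_of_frequently hL (f2.mono fun y hy => EReal.coe_le_coe_iff.2 hy)
  have := EReal.coe_le_coe_iff.1 (g1.trans g2)
  norm_num at this

/-! ### Continued fractions and their place in the Stern–Brocot sequences. -/

/-- `X i = [0; a i, a (i + 1), …]` are the complete tails of a continued fraction with partial
quotients `a`. -/
def IsContFracTails (a : ℕ → ℕ) (X : ℕ → ℝ) : Prop :=
  ∀ i, 0 < X i ∧ X i < 1 ∧ X i * (a i + X (i + 1)) = 1

/-- The convergents (numerator, denominator) of `[0; a 0, a 1, …]`, starting with `1 / 0` and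
`0 / 1`. -/
def convergent (a : ℕ → ℕ) : ℕ → ℕ × ℕ
  | 0 => (1, 0)
  | 1 => (0, 1)
  | t + 2 => convergent a t + a t • convergent a (t + 1)

/-- The denominators of the convergents, starting with `0` and `1`. -/
def convDen (a : ℕ → ℕ) (t : ℕ) : ℕ := (convergent a t).2

/-- The sum of the first `t` partial quotients. -/
def digitSum (a : ℕ → ℕ) (t : ℕ) : ℕ := ∑ i ∈ Finset.range t, a i

lemma digitSum_succ (a : ℕ → ℕ) (t : ℕ) : digitSum a (t + 1) = digitSum a t + a t :=
  Finset.sum_range_succ _ _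

/-- Compactness of [0, 1]^ℕ: the sequences satisfying the first n tail equations form decreasing
nonempty compact sets (finite continued fractions are witnesses). The strict bounds then follow from
the equations. -/
lemma exists_isContFracTails {a : ℕ → ℕ} (ha : ∀ i, 1 ≤ a i) : ∃ X, IsContFracTails a X := by
  let K : ℕ → Set (ℕ → ℝ) := fun n =>
    {y | (∀ i, y i ∈ Set.Icc (0 : ℝ) 1) ∧ ∀ i < n, y i * (a i + y (i + 1)) = 1}
  have hne : ∀ (n : ℕ) (a : ℕ → ℕ), (∀ i, 1 ≤ a i) → ∃ y : ℕ → ℝ,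
      (∀ i, y i ∈ Set.Icc (0 : ℝ) 1) ∧ ∀ i < n, y i * (a i + y (i + 1)) = 1 := by
    intro n
    induction n with
    | zero => intro a _; exact ⟨fun _ => 0, by simp, by simp⟩
    | succ n ih =>
      intro a ha
      obtain ⟨y, hy1, hy2⟩ := ih (fun i => a (i + 1)) (fun i => ha (i + 1))
      have h1 : (1 : ℝ) ≤ a 0 + y 0 := by
        have : (1 : ℝ) ≤ a 0 := by exact_mod_cast ha 0
        linarith [(hy1 0).1]
      refine ⟨fun i => Nat.casesOn i (1 / (a 0 + y 0)) y, ?_, ?_⟩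
      · rintro (_ | i)
        · exact ⟨one_div_nonneg.2 (by linarith), (div_le_one (by linarith)).2 h1⟩
        · exact hy1 i
      · rintro (_ | i) hi
        · exact one_div_mul_cancel (by linarith)
        · exact hy2 i (by omega)
  have hcl : ∀ n, IsClosed (K n) := by
    intro n
    have h1 : IsClosed {y : ℕ → ℝ | ∀ i, y i ∈ Set.Icc (0 : ℝ) 1} := by
      rw [Set.ofPred_forall]
      exact isClosed_iInter fun i => isClosed_Icc.preimage (continuous_apply i)
    have h2 : IsClosed {y : ℕ → ℝ | ∀ i < n, y i * (a i + y (i + 1)) = 1} := by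
      simp only [Set.ofPred_forall]
      exact isClosed_iInter fun i => isClosed_iInter fun _ =>
        isClosed_eq (by fun_prop) continuous_const
    exact h1.inter h2
  have hcomp : IsCompact (K 0) := by
    have : K 0 = Set.pi Set.univ fun _ => Set.Icc (0 : ℝ) 1 := by
      ext y; simp only [K, Set.mem_pi, Set.mem_univ, true_imp_iff]
      exact ⟨fun h => h.1, fun h => ⟨h, by simp⟩⟩
    rw [this]
    exact isCompact_univ_pi fun _ => isCompact_Icc
  obtain ⟨X, hX⟩ := IsCompact.nonempty_iInter_of_sequence_nonempty_isCompact_isClosed K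
    (fun n y hy => ⟨hy.1, fun i hi => hy.2 i (by omega)⟩) (fun n => hne n a ha) hcomp hcl
  rw [Set.mem_iInter] at hX
  have hI : ∀ i, X i ∈ Set.Icc (0 : ℝ) 1 := (hX 0).1
  have hE : ∀ i, X i * (a i + X (i + 1)) = 1 := fun i => (hX (i + 1)).2 i (by omega)
  have hpos : ∀ i, 0 < X i := by
    intro i
    refine lt_of_le_of_ne (hI i).1 fun h => ?_
    have := hE i
    rw [← h] at this
    simp at this
  refine ⟨X, fun i => ⟨hpos i, ?_, hE i⟩⟩
  have h1 : (1 : ℝ) ≤ a i := by exact_mod_cast ha i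
  have := hE i
  nlinarith [hpos i, hpos (i + 1)]

lemma exists_isContFracTails_of_irrational {x : ℝ} (hx : x ∈ Set.Ioo (0 : ℝ) 1)
    (hirr : Irrational x) : ∃ a X, IsContFracTails a X ∧ X 0 = x := by
  -- The orbit of x under the Gauss map.
  let X : ℕ → ℝ := fun n => Nat.rec x (fun _ y => Int.fract y⁻¹) n
  have hX : ∀ n, Irrational (X n) ∧ 0 < X n ∧ X n < 1 := by
    intro n
    induction n with
    | zero => exact ⟨hirr, hx.1, hx.2⟩
    | succ n ih =>
      have h1 : Irrational (X (n + 1)) := by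
        change Irrational (Int.fract (X n)⁻¹)
        rw [Int.fract]
        exact (irrational_inv_iff.2 ih.1).sub_intCast _
      exact ⟨h1, lt_of_le_of_ne (Int.fract_nonneg _) h1.ne_zero.symm, Int.fract_lt_one _⟩
  refine ⟨fun i => ⌊(X i)⁻¹⌋.toNat, X, fun i => ⟨(hX i).2.1, (hX i).2.2, ?_⟩, rfl⟩
  have hpos := (hX i).2.1
  have h0 : 0 ≤ ⌊(X i)⁻¹⌋ := Int.floor_nonneg.2 (by positivity)
  have h1 : ((⌊(X i)⁻¹⌋.toNat : ℕ) : ℝ) = ⌊(X i)⁻¹⌋ := by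
    exact_mod_cast Int.toNat_of_nonneg h0
  change X i * (((⌊(X i)⁻¹⌋.toNat : ℕ) : ℝ) + Int.fract (X i)⁻¹) = 1
  rw [h1, Int.floor_add_fract, mul_inv_cancel₀ hpos.ne']

/-- The form xq - p has the sign of x - p/q, so opposite signs place x inside the interval whatever
its orientation. -/
lemma SBAdj.between {s : ℤ} {n : ℕ} {u v : ℕ × ℕ} (h : SBAdj s n u v) {x : ℝ}
    (hx : (x * u.2 - u.1) * (x * v.2 - v.1) < 0) :
    0 < s * (x - fracVal u) ∧ 0 < s * (fracVal v - x) := by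
  have hu : (0 : ℝ) < u.2 := by exact_mod_cast h.left_den_pos
  have hv : (0 : ℝ) < v.2 := by exact_mod_cast h.right_den_pos
  have h1 : 0 < s * (fracVal v - fracVal u) := by rw [h.sub_eq]; positivity
  have eu : x * u.2 - u.1 = u.2 * (x - fracVal u) := by unfold fracVal; field_simp
  have ev : x * v.2 - v.1 = v.2 * (x - fracVal v) := by unfold fracVal; field_simp
  have h2 : (x - fracVal u) * (x - fracVal v) < 0 := by
    rw [eu, ev, show (u.2 : ℝ) * (x - fracVal u) * (v.2 * (x - fracVal v)) =
      (u.2 * v.2) * ((x - fracVal u) * (x - fracVal v)) by ring] at hx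
    exact (pos_iff_neg_of_mul_neg hx).1 (by positivity)
  rcases h.sign with rfl | rfl <;> push_cast at * <;>
    rcases mul_neg_iff.1 h2 with ⟨h3, h4⟩ | ⟨h3, h4⟩ <;> constructor <;> linarith

namespace IsContFracTails

variable {a : ℕ → ℕ} {X : ℕ → ℝ}

lemma one_le (h : IsContFracTails a X) (i : ℕ) : 1 ≤ a i := by
  by_contra hc
  have h0 : a i = 0 := by omega
  have h1 := h i
  have h2 := h (i + 1)
  rw [h0, Nat.cast_zero, zero_add] at h1
  nlinarith

lemma inv_eq (h : IsContFracTails a X) (i : ℕ) : (X i)⁻¹ = a i + X (i + 1) :=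
  inv_eq_of_mul_eq_one_right (h i).2.2

lemma stream_eq (h : IsContFracTails a X) (i : ℕ) :
    ∃ b, GenContFract.IntFractPair.stream (X 0) i = some ⟨b, X i⟩ := by
  induction i with
  | zero =>
    refine ⟨⌊X 0⌋, ?_⟩
    rw [GenContFract.IntFractPair.stream_zero, GenContFract.IntFractPair.of,
      Int.fract_eq_self.2 ⟨(h 0).1.le, (h 0).2.1⟩]
  | succ i ih =>
    obtain ⟨b, hb⟩ := ih
    refine ⟨⌊(X i)⁻¹⌋, ?_⟩
    rw [GenContFract.IntFractPair.stream_succ_of_some hb (h i).1.ne',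
      GenContFract.IntFractPair.of, h.inv_eq, Int.fract_natCast_add,
      Int.fract_eq_self.2 ⟨(h (i + 1)).1.le, (h (i + 1)).2.1⟩]

lemma get?_partDens (h : IsContFracTails a X) (i : ℕ) :
    (GenContFract.of (X 0)).partDens.get? i = some (a i : ℝ) := by
  obtain ⟨b, hb⟩ := h.stream_eq i
  rw [GenContFract.partDen_eq_s_b
    (GenContFract.get?_of_eq_some_of_get?_intFractPair_stream_fr_ne_zero hb (h i).1.ne')]
  simp only [GenContFract.IntFractPair.of, h.inv_eq]
  rw [Int.floor_natCast_add, Int.floor_eq_zero_iff.2 ⟨(h (i + 1)).1.le, (h (i + 1)).2.1⟩]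
  simp

lemma partialQuotientSum_eq (h : IsContFracTails a X) (t : ℕ) :
    partialQuotientSum (X 0) t = digitSum a t := by
  simp only [partialQuotientSum, partialQuotient, h.get?_partDens, Option.getD_some, digitSum]
  push_cast
  rfl

lemma irrational (h : IsContFracTails a X) : Irrational (X 0) := by
  rintro ⟨q, hq⟩
  obtain ⟨n, hn⟩ := (GenContFract.terminates_iff_rat (X 0)).2 ⟨q, hq.symm⟩
  have h1 : (GenContFract.of (X 0)).partDens.get? n = none :=
    GenContFract.terminatedAt_iff_partDen_none.1 hn
  rw [h.get?_partDens] at h1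
  simp at h1

lemma convergent_error (h : IsContFracTails a X) (t : ℕ) :
    X 0 * (convergent a (t + 1)).2 - (convergent a (t + 1)).1 =
      -X t * (X 0 * (convergent a t).2 - (convergent a t).1) := by
  induction t with
  | zero => simp [convergent]
  | succ t ih =>
    have h1 := (h t).2.2
    have e : convergent a (t + 2) = convergent a t + a t • convergent a (t + 1) := rfl
    rw [e]
    simp only [Prod.snd_add, Prod.fst_add, Prod.smul_snd, Prod.smul_fst, smul_eq_mul]
    push_cast
    set p := X 0 * ((convergent a t).2 : ℝ) - (convergent a t).1
    linear_combination (a t + X (t + 1)) * ih - p * h1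

lemma convergent_error_ne_zero (h : IsContFracTails a X) (t : ℕ) :
    X 0 * (convergent a t).2 - (convergent a t).1 ≠ 0 := by
  induction t with
  | zero => simp [convergent]
  | succ t ih =>
    rw [h.convergent_error]
    exact mul_ne_zero (neg_ne_zero.2 (h t).1.ne') ih

/-- The Stern–Brocot neighbours of `X 0` are the convergents and intermediate fractions. -/
lemma exists_adj (h : IsContFracTails a X) {t b : ℕ} (hb : b ≤ a t) (h1 : 1 ≤ digitSum a t + b) :
    ∃ s, SBAdj s (digitSum a t + b - 1) (convergent a (t + 1))
        (convergent a t + b • convergent a (t + 1)) ∧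
      0 < s * (X 0 - fracVal (convergent a (t + 1))) ∧
      0 < s * (fracVal (convergent a t + b • convergent a (t + 1)) - X 0) := by
  -- Adjacency alone does not need `b ≤ a t`. Each digit is a run of mediants toward a fixed
  -- convergent, after which the endpoints swap roles and the orientation flips. The case t = b = 0
  -- is excluded because its pair 0/1, 1/0 precedes level 0.
  have hadj : ∀ t b : ℕ, 1 ≤ digitSum a t + b → ∃ s, SBAdj s (digitSum a t + b - 1)
      (convergent a (t + 1)) (convergent a t + b • convergent a (t + 1)) := by
    intro t
    induction t with
    | zero =>
      intro b hb
      obtain ⟨c, rfl⟩ : ∃ c, b = c + 1 := ⟨b - 1, by simp [digitSum] at hb; omega⟩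
      have h0 : SBAdj 1 0 (0, 1) (1, 1) := ⟨0, by simp, Or.inl ⟨rfl, rfl, rfl⟩⟩
      refine ⟨1, ?_⟩
      have := h0.iterate c
      have e : convergent a 0 + (c + 1) • convergent a (0 + 1) = (1, 1) + c • (0, 1) := by
        simp [convergent, add_comm]
      rw [e]
      simpa [digitSum, convergent] using this
    | succ t ih =>
      intro b hb
      have ha := h.one_le t
      obtain ⟨s, hs⟩ := ih (a t) (by omega)
      refine ⟨-s, ?_⟩
      have := hs.symm.iterate b
      rw [digitSum_succ]
      rwa [show digitSum a t + a t - 1 + b = digitSum a t + a t + b - 1 by omega] at this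
  obtain ⟨s, hs⟩ := hadj t b h1
  refine ⟨s, hs, hs.between ?_⟩
  have e := h.convergent_error t
  simp only [Prod.snd_add, Prod.fst_add, Prod.smul_snd, Prod.smul_fst, smul_eq_mul]
  push_cast
  have hne := h.convergent_error_ne_zero t
  set p := X 0 * ((convergent a t).2 : ℝ) - (convergent a t).1
  set r := X 0 * ((convergent a (t + 1)).2 : ℝ) - (convergent a (t + 1)).1
  -- The product is negative because b X_t ≤ a_t X_t < 1; this is where `b ≤ a t` enters.
  have e2 : r * (X 0 * ((convergent a t).2 + b * (convergent a (t + 1)).2) -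
      ((convergent a t).1 + b * (convergent a (t + 1)).1)) = -(X t * (1 - b * X t) * p ^ 2) := by
    rw [show X 0 * ((convergent a t).2 + b * (convergent a (t + 1)).2) -
      ((convergent a t).1 + b * (convergent a (t + 1)).1) = p + b * r by ring, e]
    ring
  rw [e2, neg_lt_zero]
  obtain ⟨h2, h3, h4⟩ := h t
  have h5 := (h (t + 1)).1
  have h6 : (b : ℝ) ≤ a t := by exact_mod_cast hb
  have : b * X t < 1 := by nlinarith [mul_pos h2 h5]
  have : 0 < 1 - b * X t := by linarith
  positivity

end IsContFracTails

/-! ### The numbers λ_j and their geometric majorant. -/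

lemma lambdaConst_sq (j : ℕ) : lambdaConst j ^ 2 = j * lambdaConst j + 1 := by
  unfold lambdaConst
  have := Real.sq_sqrt (show (0 : ℝ) ≤ (j : ℝ) ^ 2 + 4 by positivity)
  linear_combination this / 4

lemma lambdaConst_pos (j : ℕ) : 0 < lambdaConst j := by
  unfold lambdaConst
  have : 0 < Real.sqrt ((j : ℝ) ^ 2 + 4) := Real.sqrt_pos.2 (by positivity)
  positivity

lemma one_le_lambdaConst (j : ℕ) : 1 ≤ lambdaConst j := by
  have h1 := lambdaConst_sq j
  have h2 := lambdaConst_pos j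
  have : (0 : ℝ) ≤ j * lambdaConst j := by positivity
  nlinarith

lemma natCast_le_lambdaConst (j : ℕ) : (j : ℝ) ≤ lambdaConst j := by
  have h1 := lambdaConst_sq j
  have h2 := lambdaConst_pos j
  nlinarith

lemma lambdaConst_succ_le (j : ℕ) : lambdaConst (j + 1) ≤ lambdaConst j + 1 := by
  unfold lambdaConst
  have h1 := Real.sq_sqrt (show (0 : ℝ) ≤ (j : ℝ) ^ 2 + 4 by positivity)
  have h2 : (j : ℝ) ≤ Real.sqrt ((j : ℝ) ^ 2 + 4) := Real.le_sqrt_of_sq_le (by linarith)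
  have h3 : Real.sqrt (((j + 1 : ℕ) : ℝ) ^ 2 + 4) ≤ Real.sqrt ((j : ℝ) ^ 2 + 4) + 1 := by
    apply Real.sqrt_le_iff.2
    constructor
    · positivity
    · push_cast; nlinarith
  push_cast at *
  linarith

lemma lambdaConst_lt_of_sq {j : ℕ} {c : ℝ} (hc : 1 ≤ c) (h : j * c + 1 < c ^ 2) :
    lambdaConst j < c := by
  have h1 := lambdaConst_sq j
  have h2 := one_le_lambdaConst j
  by_contra! hn
  have hj : (j : ℝ) < c := by nlinarith
  nlinarith

lemma lt_lambdaConst_of_sq {j : ℕ} {c : ℝ} (hc : 1 ≤ c) (h : c ^ 2 < j * c + 1) :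
    c < lambdaConst j := by
  have h1 := lambdaConst_sq j
  have h2 := one_le_lambdaConst j
  by_contra! hn
  have hj : (j : ℝ) ≤ lambdaConst j := natCast_le_lambdaConst j
  nlinarith

lemma lambdaConst_four_bounds : 4.236 < lambdaConst 4 ∧ lambdaConst 4 < 4.2361 :=
  ⟨lt_lambdaConst_of_sq (by norm_num) (by norm_num),
    lambdaConst_lt_of_sq (by norm_num) (by norm_num)⟩

lemma lambdaConst_five_bounds : 5.1925 < lambdaConst 5 ∧ lambdaConst 5 < 5.1926 :=
  ⟨lt_lambdaConst_of_sq (by norm_num) (by norm_num),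
    lambdaConst_lt_of_sq (by norm_num) (by norm_num)⟩

/-- The ratio `λ₅ / λ₄`. -/
noncomputable def lambdaRatio : ℝ := lambdaConst 5 / lambdaConst 4

lemma lambdaRatio_bounds : 1.225 < lambdaRatio ∧ lambdaRatio < 1.226 := by
  obtain ⟨h1, h2⟩ := lambdaConst_four_bounds
  obtain ⟨h3, h4⟩ := lambdaConst_five_bounds
  unfold lambdaRatio
  constructor
  · rw [lt_div_iff₀ (by linarith)]; linarith
  · rw [div_lt_iff₀ (by linarith)]; linarith

lemma lambdaRatio_pos : 0 < lambdaRatio := by linarith [lambdaRatio_bounds.1]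

/-- The inverse square of the majorant `λ₄ (λ₅ / λ₄) ^ (j - 4)` of `λ_j`. -/
noncomputable def digitWeight (j : ℕ) : ℝ :=
  lambdaRatio ^ 8 / lambdaConst 4 ^ 2 / (lambdaRatio ^ 2) ^ j

lemma digitWeight_pos (j : ℕ) : 0 < digitWeight j := by
  have := lambdaRatio_pos
  have := lambdaConst_pos 4
  unfold digitWeight; positivity

lemma digitWeight_four : digitWeight 4 = 1 / lambdaConst 4 ^ 2 := by
  have := lambdaRatio_pos
  unfold digitWeight; field_simp

lemma digitWeight_five : digitWeight 5 = 1 / lambdaConst 5 ^ 2 := by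
  have h1 := lambdaConst_pos 4
  have h2 := lambdaConst_pos 5
  unfold digitWeight lambdaRatio; field_simp

lemma digitWeight_succ (j : ℕ) : digitWeight (j + 1) = digitWeight j / lambdaRatio ^ 2 := by
  have := lambdaRatio_pos
  unfold digitWeight; rw [pow_succ (lambdaRatio ^ 2)]; field_simp

/-- For j ≥ 5 the ratio λ_{j+1}/λ_j ≤ 1 + 1/j ≤ 1.2 is smaller than the ratio λ₅/λ₄ of the majorant.
-/
lemma lambdaConst_sq_mul_digitWeight_succ_le {j : ℕ} (hj : 5 ≤ j) :
    lambdaConst (j + 1) ^ 2 * digitWeight (j + 1) ≤ 0.97 * (lambdaConst j ^ 2 * digitWeight j) := by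
  have h1 := lambdaConst_succ_le j
  have h2 := natCast_le_lambdaConst j
  have h3 : (5 : ℝ) ≤ j := by exact_mod_cast hj
  have h4 := lambdaConst_pos (j + 1)
  have h5 : lambdaConst (j + 1) ≤ 1.2 * lambdaConst j := by linarith
  have h6 : lambdaConst (j + 1) ^ 2 ≤ 1.44 * lambdaConst j ^ 2 := by nlinarith
  have h7 := lambdaRatio_bounds.1
  have h8 : 1.5 ≤ lambdaRatio ^ 2 := by nlinarith
  have h9 := digitWeight_pos j
  rw [digitWeight_succ, ← mul_div_assoc, div_le_iff₀ (by positivity)]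
  have h10 : 0 < lambdaConst j ^ 2 * digitWeight j := by
    have := lambdaConst_pos j
    positivity
  nlinarith

lemma lambdaConst_sq_mul_digitWeight_le {j : ℕ} (h4 : j ≠ 4) (h5 : j ≠ 5) :
    lambdaConst j ^ 2 * digitWeight j ≤ 0.97 := by
  rcases Nat.lt_or_ge j 6 with hj | hj
  · have hr1 := lambdaRatio_pos
    have hr2 : lambdaRatio ^ 2 ≤ 1.51 := by nlinarith [lambdaRatio_bounds.2]
    have hr4 : lambdaRatio ^ 4 ≤ 1.51 ^ 2 := by
      calc lambdaRatio ^ 4 = (lambdaRatio ^ 2) ^ 2 := by ring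
        _ ≤ _ := by gcongr
    have hr6 : lambdaRatio ^ 6 ≤ 1.51 ^ 3 := by
      calc lambdaRatio ^ 6 = (lambdaRatio ^ 2) ^ 3 := by ring
        _ ≤ _ := by gcongr
    have hr8 : lambdaRatio ^ 8 ≤ 1.51 ^ 4 := by
      calc lambdaRatio ^ 8 = (lambdaRatio ^ 2) ^ 4 := by ring
        _ ≤ _ := by gcongr
    have h4b : 17.9 ≤ lambdaConst 4 ^ 2 := by nlinarith [lambdaConst_four_bounds.1]
    -- `c` bounds λ_j and `d` bounds (λ₅/λ₄)^{2(4-j)}; four numerical cases j = 0, …, 3 remain.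
    have key : ∀ c d : ℝ, 0 ≤ c → lambdaConst j < c → digitWeight j * lambdaConst 4 ^ 2 ≤ d →
        c ^ 2 * d ≤ 0.97 * 17.9 → lambdaConst j ^ 2 * digitWeight j ≤ 0.97 := by
      intro c d hc hcj hd hcd
      have h0 := lambdaConst_pos j
      have h1 : lambdaConst j ^ 2 ≤ c ^ 2 := by gcongr
      have h2 := digitWeight_pos j
      have h3 : lambdaConst j ^ 2 * (digitWeight j * lambdaConst 4 ^ 2) ≤ c ^ 2 * d := by
        gcongr
      nlinarith
    have h4p := lambdaConst_pos 4
    interval_cases j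
    · refine key 1.01 (1.51 ^ 4) (by norm_num)
        (lambdaConst_lt_of_sq (by norm_num) (by norm_num)) ?_ (by norm_num)
      refine le_trans (le_of_eq ?_) hr8
      unfold digitWeight; field_simp
    · refine key 1.62 (1.51 ^ 3) (by norm_num)
        (lambdaConst_lt_of_sq (by norm_num) (by norm_num)) ?_ (by norm_num)
      refine le_trans (le_of_eq ?_) hr6
      unfold digitWeight; field_simp
    · refine key 2.42 (1.51 ^ 2) (by norm_num)
        (lambdaConst_lt_of_sq (by norm_num) (by norm_num)) ?_ (by norm_num)
      refine le_trans (le_of_eq ?_) hr4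
      unfold digitWeight; field_simp
    · refine key 3.303 1.51 (by norm_num)
        (lambdaConst_lt_of_sq (by norm_num) (by norm_num)) ?_ (by norm_num)
      refine le_trans (le_of_eq ?_) hr2
      unfold digitWeight; field_simp
    · simp at h4
    · simp at h5
  · have h0 : lambdaConst 5 ^ 2 * digitWeight 5 = 1 := by
      have := lambdaConst_pos 5
      rw [digitWeight_five]; field_simp
    have main : ∀ d : ℕ, lambdaConst (d + 6) ^ 2 * digitWeight (d + 6) ≤ 0.97 := by
      intro d
      induction d with
      | zero =>
        have := lambdaConst_sq_mul_digitWeight_succ_le (le_refl 5)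
        rw [h0, mul_one] at this
        exact this
      | succ d ih =>
        have := lambdaConst_sq_mul_digitWeight_succ_le (show 5 ≤ d + 6 by omega)
        rw [show d + 1 + 6 = d + 6 + 1 by ring]
        linarith
    obtain ⟨d, rfl⟩ := Nat.exists_eq_add_of_le' hj
    exact main d

lemma lambdaConst_sq_mul_digitWeight_le_one (j : ℕ) :
    lambdaConst j ^ 2 * digitWeight j ≤ 1 := by
  by_cases h4 : j = 4
  · subst h4
    have := lambdaConst_pos 4
    rw [digitWeight_four]; apply le_of_eq; field_simp
  by_cases h5 : j = 5
  · subst h5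
    have := lambdaConst_pos 5
    rw [digitWeight_five]; apply le_of_eq; field_simp
  linarith [lambdaConst_sq_mul_digitWeight_le h4 h5]

/-! ### Growth of the denominators and its defect from the majorant. -/

lemma convDen_succ_succ (a : ℕ → ℕ) (t : ℕ) :
    convDen a (t + 2) = convDen a t + a t * convDen a (t + 1) := by
  simp [convDen, convergent]

/-- The squared Euclidean norm of two consecutive denominators. -/
noncomputable def denNormSq (a : ℕ → ℕ) (t : ℕ) : ℝ :=
  (convDen a (t + 1) : ℝ) ^ 2 + (convDen a t : ℝ) ^ 2

lemma denNormSq_nonneg (a : ℕ → ℕ) (t : ℕ) : 0 ≤ denNormSq a t := by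
  unfold denNormSq; positivity

/-- The matrix ((j, 1), (1, 0)) is symmetric with eigenvalues λ_j and -1/λ_j, hence has norm λ_j.
The identity `e` measures the loss by the component orthogonal to the leading eigenvector (λ_j, 1).
-/
lemma denNormSq_succ_le (a : ℕ → ℕ) (t : ℕ) :
    denNormSq a (t + 1) ≤ lambdaConst (a t) ^ 2 * denNormSq a t := by
  unfold denNormSq
  rw [convDen_succ_succ]
  push_cast
  set q : ℝ := (convDen a (t + 1) : ℝ)
  set p : ℝ := (convDen a t : ℝ)
  have h1 := lambdaConst_sq (a t)
  have h2 := one_le_lambdaConst (a t)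
  set l := lambdaConst (a t)
  have h3 : (0 : ℝ) < l ^ 2 := by positivity
  have e : l ^ 2 * (l ^ 2 * (q ^ 2 + p ^ 2) - ((p + a t * q) ^ 2 + q ^ 2)) =
      (l ^ 2 - 1) * (q - l * p) ^ 2 := by
    have e1 : (a t : ℝ) * l = l ^ 2 - 1 := by linarith
    have e2 : l ^ 2 * (p + a t * q) ^ 2 = (l * p + (l ^ 2 - 1) * q) ^ 2 := by
      rw [← e1]; ring
    linear_combination -e2
  have h4 : 0 ≤ (l ^ 2 - 1) * (q - l * p) ^ 2 := by
    have : 0 ≤ l ^ 2 - 1 := by nlinarith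
    positivity
  rw [← e] at h4
  have := nonneg_of_mul_nonneg_right h4 h3
  linarith

/-- The constant is the squared Frobenius norm 21² + 5² + 4² + 1² of the product of the two
matrices. It is smaller than λ₄²λ₅² ≈ 483.8. -/
lemma denNormSq_add_two_le (a : ℕ → ℕ) (t : ℕ)
    (h : (a t = 4 ∧ a (t + 1) = 5) ∨ (a t = 5 ∧ a (t + 1) = 4)) :
    denNormSq a (t + 2) ≤ 483 * denNormSq a t := by
  unfold denNormSq
  rw [convDen_succ_succ a (t + 1), convDen_succ_succ a t]
  push_cast
  set q : ℝ := (convDen a (t + 1) : ℝ)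
  set p : ℝ := (convDen a t : ℝ)
  rcases h with ⟨h1, h2⟩ | ⟨h1, h2⟩ <;> rw [h1, h2] <;> push_cast
  · nlinarith [sq_nonneg (q - 5 * p), sq_nonneg (21 * p - 5 * q), sq_nonneg (4 * p - q)]
  · nlinarith [sq_nonneg (q - 4 * p), sq_nonneg (21 * p - 4 * q), sq_nonneg (5 * p - q)]

/-- The squared norm of two consecutive denominators, divided by the square of its majorant. -/
noncomputable def denDefect (a : ℕ → ℕ) (t : ℕ) : ℝ :=
  denNormSq a t * ∏ i ∈ Finset.range t, digitWeight (a i)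

lemma prod_digitWeight_pos (a : ℕ → ℕ) (t : ℕ) : 0 < ∏ i ∈ Finset.range t, digitWeight (a i) :=
  Finset.prod_pos fun _ _ => digitWeight_pos _

lemma denDefect_nonneg (a : ℕ → ℕ) (t : ℕ) : 0 ≤ denDefect a t :=
  mul_nonneg (denNormSq_nonneg a t) (prod_digitWeight_pos a t).le

lemma denDefect_succ_le (a : ℕ → ℕ) (t : ℕ) :
    denDefect a (t + 1) ≤ lambdaConst (a t) ^ 2 * digitWeight (a t) * denDefect a t := by
  unfold denDefect
  rw [Finset.prod_range_succ]
  have h1 := denNormSq_succ_le a t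
  have h2 := prod_digitWeight_pos a t
  have h3 := digitWeight_pos (a t)
  calc _ ≤ lambdaConst (a t) ^ 2 * denNormSq a t *
      ((∏ i ∈ Finset.range t, digitWeight (a i)) * digitWeight (a t)) := by gcongr
    _ = _ := by ring

lemma denDefect_antitone (a : ℕ → ℕ) : Antitone (denDefect a) :=
  antitone_nat_of_succ_le fun t => (denDefect_succ_le a t).trans
    (mul_le_of_le_one_left (denDefect_nonneg a t) (lambdaConst_sq_mul_digitWeight_le_one _))

lemma denDefect_add_two_le_of_digit (a : ℕ → ℕ) (t : ℕ) (h4 : a t ≠ 4) (h5 : a t ≠ 5) :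
    denDefect a (t + 2) ≤ 0.999 * denDefect a t := by
  have h1 := denDefect_antitone a (show t + 1 ≤ t + 2 by omega)
  have h2 := denDefect_succ_le a t
  have h3 := lambdaConst_sq_mul_digitWeight_le h4 h5
  have h6 := denDefect_nonneg a t
  nlinarith

lemma denDefect_add_two_le_of_change (a : ℕ → ℕ) (t : ℕ)
    (h : (a t = 4 ∧ a (t + 1) = 5) ∨ (a t = 5 ∧ a (t + 1) = 4)) :
    denDefect a (t + 2) ≤ 0.999 * denDefect a t := by
  have h1 := denNormSq_add_two_le a t h
  have h2 := prod_digitWeight_pos a t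
  have e : digitWeight (a t) * digitWeight (a (t + 1)) =
      1 / (lambdaConst 4 ^ 2 * lambdaConst 5 ^ 2) := by
    rcases h with ⟨h3, h4⟩ | ⟨h3, h4⟩ <;> rw [h3, h4, digitWeight_four, digitWeight_five] <;> ring
  have h3 : 483 * (digitWeight (a t) * digitWeight (a (t + 1))) ≤ 0.999 := by
    rw [e, mul_one_div, div_le_iff₀ (by have := lambdaConst_pos 4; have := lambdaConst_pos 5; positivity)]
    have h4 := lambdaConst_four_bounds.1
    have h5 := lambdaConst_five_bounds.1
    have h6 : (4.236 : ℝ) ^ 2 ≤ lambdaConst 4 ^ 2 := by gcongr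
    have h7 : (5.1925 : ℝ) ^ 2 ≤ lambdaConst 5 ^ 2 := by gcongr
    have h8 : (4.236 : ℝ) ^ 2 * 5.1925 ^ 2 ≤ lambdaConst 4 ^ 2 * lambdaConst 5 ^ 2 := by gcongr
    norm_num at h8 ⊢
    linarith
  unfold denDefect
  rw [Finset.prod_range_succ, Finset.prod_range_succ]
  have h4 := digitWeight_pos (a t)
  have h5 := digitWeight_pos (a (t + 1))
  have h6 := denNormSq_nonneg a t
  calc _ ≤ 483 * denNormSq a t * ((∏ i ∈ Finset.range t, digitWeight (a i)) * digitWeight (a t) *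
        digitWeight (a (t + 1))) := by gcongr
    _ = 483 * (digitWeight (a t) * digitWeight (a (t + 1))) *
        (denNormSq a t * ∏ i ∈ Finset.range t, digitWeight (a i)) := by ring
    _ ≤ _ := by gcongr

/-- The limit L ≥ 0 of G satisfies L ≤ ρL. -/
lemma tendsto_zero_of_frequently_le {G : ℕ → ℝ} (hG : Antitone G) (h0 : ∀ t, 0 ≤ G t) {ρ : ℝ}
    (hρ : ρ < 1) {k : ℕ} (h : ∃ᶠ t in atTop, G (t + k) ≤ ρ * G t) : Tendsto G atTop (𝓝 0) := by
  have hbdd : BddBelow (Set.range G) := ⟨0, by rintro _ ⟨t, rfl⟩; exact h0 t⟩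
  have hlim := tendsto_atTop_ciInf hG hbdd
  set L := ⨅ t, G t
  have hL0 : 0 ≤ L := le_ciInf h0
  have h1 : Tendsto (fun t => G (t + k) - ρ * G t) atTop (𝓝 (L - ρ * L)) :=
    (hlim.comp (tendsto_add_atTop_nat k)).sub (hlim.const_mul ρ)
  have h2 : L - ρ * L ≤ 0 :=
    le_of_tendsto_of_frequently h1 (h.mono fun t ht => by linarith)
  have : L = 0 := by nlinarith
  rwa [this] at hlim

/-! ### The role of κ₂, and decay under the hypothesis of (i). -/

/-- `log (√2 λ₄ / λ₅)`, the opposite of the denominator of `κ₂`. -/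
noncomputable def kappaDen : ℝ :=
  Real.log (Real.sqrt 2) + Real.log (lambdaConst 4) - Real.log (lambdaConst 5)

lemma kappaDen_pos : 0 < kappaDen := by
  unfold kappaDen
  have h4 := lambdaConst_four_bounds.1
  have h5 := lambdaConst_five_bounds.2
  have h2 : (1.4 : ℝ) ≤ Real.sqrt 2 := Real.le_sqrt_of_sq_le (by norm_num)
  rw [← Real.log_mul (by positivity) (by linarith), sub_pos]
  apply Real.log_lt_log (lambdaConst_pos 5)
  nlinarith

lemma kappaDen_mul_kappaTwo :
    kappaDen * kappaTwo = 5 * Real.log (lambdaConst 4) - 4 * Real.log (lambdaConst 5) := by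
  have h := kappaDen_pos
  have e : Real.log (lambdaConst 5) - Real.log (lambdaConst 4) - Real.log (Real.sqrt 2) =
      -kappaDen := by unfold kappaDen; ring
  unfold kappaTwo
  rw [e]
  field_simp
  ring

lemma kappaDen_mul_kappaTwo_sub_four :
    kappaDen * (kappaTwo - 4) = Real.log (lambdaConst 4) - 4 * Real.log (Real.sqrt 2) := by
  rw [mul_sub, kappaDen_mul_kappaTwo]; unfold kappaDen; ring

lemma kappaDen_mul_five_sub_kappaTwo :
    kappaDen * (5 - kappaTwo) = 5 * Real.log (Real.sqrt 2) - Real.log (lambdaConst 5) := by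
  rw [mul_sub, kappaDen_mul_kappaTwo]; unfold kappaDen; ring

lemma log_sqrt_two : Real.log (Real.sqrt 2) = Real.log 2 / 2 := Real.log_sqrt (by norm_num)

/-- Amounts to λ₄² > 2⁴: under constant digits 4 the denominators win against the powers of two. -/
lemma four_lt_kappaTwo : 4 < kappaTwo := by
  have h : 0 < kappaDen * (kappaTwo - 4) := by
    rw [kappaDen_mul_kappaTwo_sub_four, log_sqrt_two, sub_pos]
    have : 4 * (Real.log 2 / 2) = Real.log (2 ^ 2) := by rw [Real.log_pow]; push_cast; ring
    rw [this]
    apply Real.log_lt_log (by norm_num)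
    linarith [lambdaConst_four_bounds.1]
  linarith [(pos_iff_pos_of_mul_pos h).1 kappaDen_pos]

/-- Amounts to λ₅² < 2⁵: under constant digits 5 the powers of two win. -/
lemma kappaTwo_lt_five : kappaTwo < 5 := by
  have h : 0 < kappaDen * (5 - kappaTwo) := by
    rw [kappaDen_mul_five_sub_kappaTwo, log_sqrt_two, sub_pos]
    have h1 : 2 * Real.log (lambdaConst 5) = Real.log (lambdaConst 5 ^ 2) := by
      rw [Real.log_pow]; push_cast; ring
    have h2 : 5 * Real.log 2 = Real.log (2 ^ 5) := by rw [Real.log_pow]; push_cast; ring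
    have h3 : Real.log (lambdaConst 5 ^ 2) < Real.log (2 ^ 5) := by
      apply Real.log_lt_log (by have := lambdaConst_pos 5; positivity)
      nlinarith [lambdaConst_five_bounds.2, lambdaConst_five_bounds.1]
    linarith
  linarith [(pos_iff_pos_of_mul_pos h).1 kappaDen_pos]

/-- The logarithm of the left side is affine in j with slope 2D, where D is `kappaDen`, and κ₂ is
its zero. -/
lemma digitWeight_eq_exp (j : ℕ) :
    digitWeight j * 2 ^ j = Real.exp (2 * kappaDen * (j - kappaTwo)) := by
  have h4 := lambdaConst_pos 4
  have h5 := lambdaConst_pos 5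
  have hr := lambdaRatio_pos
  have e : 2 * kappaDen * (j - kappaTwo) = Real.log (digitWeight j * 2 ^ j) := by
    have hw := digitWeight_pos j
    rw [Real.log_mul hw.ne' (by positivity)]
    unfold digitWeight
    rw [Real.log_div (by positivity) (by positivity), Real.log_div (by positivity) (by positivity),
      ← pow_mul]
    simp only [Real.log_pow]
    unfold lambdaRatio
    rw [Real.log_div h5.ne' h4.ne']
    have h1 := kappaDen_mul_kappaTwo
    have h2 := log_sqrt_two
    have h3 : kappaDen = Real.log (Real.sqrt 2) + Real.log (lambdaConst 4) -
      Real.log (lambdaConst 5) := rfl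
    push_cast
    linear_combination (-2) * h1 + 2 * (j : ℝ) * h3 + 2 * (j : ℝ) * h2
  rw [e, Real.exp_log (by have := digitWeight_pos j; positivity)]

lemma prod_digitWeight_eq_exp (a : ℕ → ℕ) (t : ℕ) :
    (∏ i ∈ Finset.range t, digitWeight (a i)) * 2 ^ digitSum a t =
      Real.exp (2 * kappaDen * (digitSum a t - kappaTwo * t)) := by
  induction t with
  | zero => simp [digitSum]
  | succ t ih =>
    rw [Finset.prod_range_succ, digitSum_succ, pow_add, mul_mul_mul_comm, ih, digitWeight_eq_exp,
      ← Real.exp_add]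
    push_cast
    ring_nf

lemma denNormSq_div_eq (a : ℕ → ℕ) (t : ℕ) :
    denNormSq a t / 2 ^ digitSum a t =
      denDefect a t * Real.exp (2 * kappaDen * (kappaTwo * t - digitSum a t)) := by
  have h1 := prod_digitWeight_eq_exp a t
  have h2 : Real.exp (2 * kappaDen * (kappaTwo * t - digitSum a t)) *
      Real.exp (2 * kappaDen * (digitSum a t - kappaTwo * t)) = 1 := by
    rw [← Real.exp_add, ← Real.exp_zero]; ring_nf
  rw [← h1] at h2
  unfold denDefect
  rw [div_eq_iff (by positivity)]
  linear_combination (-denNormSq a t) * h2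

lemma digitSum_const_block {a : ℕ → ℕ} {T c n : ℕ} (h : ∀ t, T ≤ t → t < T + n → a t = c) :
    digitSum a (T + n) = digitSum a T + c * n := by
  induction n with
  | zero => simp
  | succ n ih =>
    rw [← add_assoc, digitSum_succ, ih fun t h1 h2 => h t h1 (by omega),
      h (T + n) (by omega) (by omega)]
    ring

lemma tendsto_denNormSq_div {a : ℕ → ℕ} {C : ℝ}
    (h : ∀ t : ℕ, 1 ≤ t → kappaTwo * t - C ≤ digitSum a t) :
    Tendsto (fun t => denNormSq a t / 2 ^ digitSum a t) atTop (𝓝 0) := by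
  simp only [denNormSq_div_eq]
  have hD := kappaDen_pos
  by_cases hf : ∃ᶠ t in atTop, denDefect a (t + 2) ≤ 0.999 * denDefect a t
  · have h1 := tendsto_zero_of_frequently_le (denDefect_antitone a) (denDefect_nonneg a)
      (by norm_num) hf
    have h2 := h1.mul_const (Real.exp (2 * kappaDen * C))
    rw [zero_mul] at h2
    refine tendsto_of_tendsto_of_tendsto_of_le_of_le' tendsto_const_nhds h2 ?_ ?_
    · exact Eventually.of_forall fun t => mul_nonneg (denDefect_nonneg a t) (Real.exp_pos _).le
    · filter_upwards [eventually_ge_atTop 1] with t ht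
      have := h t ht
      have := denDefect_nonneg a t
      gcongr
      linarith
  -- Without recurrent losses the digits are eventually all 4 or all 5.
  · rw [not_frequently, eventually_atTop] at hf
    obtain ⟨T, hT⟩ := hf
    have h45 : ∀ t ≥ T, a t = 4 ∨ a t = 5 := by
      intro t ht
      by_contra! hc
      exact hT t ht (denDefect_add_two_le_of_digit a t hc.1 hc.2)
    have hconst : ∀ t ≥ T, a t = a T := by
      intro t ht
      induction t, ht using Nat.le_induction with
      | base => rfl
      | succ t ht ih =>
        rw [← ih]
        have h1 := h45 t ht
        have h2 := h45 (t + 1) (by omega)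
        by_contra hc
        exact hT t ht (denDefect_add_two_le_of_change a t (by omega))
    rcases h45 T le_rfl with h4 | h5
    · exfalso
      rw [h4] at hconst
      have hk := four_lt_kappaTwo
      obtain ⟨d, hd⟩ := exists_nat_gt ((digitSum a T + C - kappaTwo * T) / (kappaTwo - 4))
      rw [div_lt_iff₀ (by linarith)] at hd
      have h1 := h (T + (d + 1)) (by omega)
      rw [digitSum_const_block fun t ht _ => hconst t ht] at h1
      push_cast at h1
      nlinarith
    · rw [h5] at hconst
      have hk := kappaTwo_lt_five
      have hexp : Tendsto (fun t : ℕ => kappaTwo * t - digitSum a t) atTop atBot := by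
        have h1 : Tendsto (fun t : ℕ => (5 * T : ℝ) - (5 - kappaTwo) * t) atTop atBot :=
          tendsto_atBot_add_const_left _ _ (tendsto_neg_atTop_atBot.comp
            (tendsto_natCast_atTop_atTop.const_mul_atTop (by linarith)))
        refine tendsto_atBot_mono' _ ?_ h1
        filter_upwards [eventually_ge_atTop T] with t ht
        obtain ⟨d, rfl⟩ := Nat.exists_eq_add_of_le ht
        rw [digitSum_const_block fun t ht _ => hconst t ht]
        push_cast
        have : (0 : ℝ) ≤ digitSum a T := by positivity
        linarith
      have h2 := (Real.tendsto_exp_atBot.comp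
        (hexp.const_mul_atBot (show 0 < 2 * kappaDen by linarith))).const_mul (denDefect a 0)
      rw [mul_zero] at h2
      refine squeeze_zero (fun t => mul_nonneg (denDefect_nonneg a t) (Real.exp_pos _).le) ?_ h2
      intro t
      exact mul_le_mul_of_nonneg_right (denDefect_antitone a (Nat.zero_le t)) (Real.exp_pos _).le

/-! ### Vanishing derivative: from convergents to all levels. -/

lemma add_two_sq_le (b : ℕ) : ((b : ℝ) + 2) ^ 2 ≤ 9 * 2 ^ b := by
  induction b with
  | zero => norm_num
  | succ b ih =>
    rcases Nat.eq_zero_or_pos b with rfl | hb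
    · norm_num
    · have : (1 : ℝ) ≤ b := by exact_mod_cast hb
      rw [pow_succ 2]; push_cast; nlinarith

lemma digitSum_ge {a : ℕ → ℕ} (ha : ∀ i, 1 ≤ a i) (t : ℕ) : t ≤ digitSum a t := by
  induction t with
  | zero => simp
  | succ t ih => rw [digitSum_succ]; have := ha t; omega

lemma digitSum_mono (a : ℕ → ℕ) : Monotone (digitSum a) :=
  monotone_nat_of_le_succ fun t => by rw [digitSum_succ]; omega

lemma convDen_le_succ {a : ℕ → ℕ} (ha : ∀ i, 1 ≤ a i) (t : ℕ) :
    convDen a t ≤ convDen a (t + 1) := by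
  rcases t with _ | t
  · simp [convDen, convergent]
  · rw [convDen_succ_succ]
    have := Nat.le_mul_of_pos_left (convDen a (t + 1)) (ha t)
    omega

theorem hasDerivAt_minkowskiQuestionMark_zero {x : ℝ} (hx : x ∈ Set.Ioo (0 : ℝ) 1)
    (hirr : Irrational x) {C : ℝ}
    (hC : ∀ t : ℕ, 1 ≤ t → kappaTwo * (t : ℝ) - C ≤ partialQuotientSum x t) :
    HasDerivAt minkowskiQuestionMark 0 x := by
  obtain ⟨a, X, h, rfl⟩ := exists_isContFracTails_of_irrational hx hirr
  simp only [h.partialQuotientSum_eq] at hC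
  have hlim := tendsto_denNormSq_div hC
  apply hasDerivAt_zero_of_forall_level hirr
  intro ε hε
  -- 18 = 9 · 2: the 9 absorbs (b + 2)² into 2ᵇ, the 2 comes from n = S_t + b - 1.
  obtain ⟨T, hT⟩ := eventually_atTop.1 (hlim.eventually (gt_mem_nhds (show 0 < ε / 18 by linarith)))
  refine ⟨digitSum a (T + 1), fun n hn => ?_⟩
  have hex : ∃ t, n + 1 < digitSum a (t + 1) := by
    refine ⟨n + 1, ?_⟩
    have := digitSum_ge h.one_le (n + 2)
    exact this
  classical
  -- The digit during whose run of mediants level n occurs.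
  obtain ⟨t, ht1, ht2⟩ : ∃ t, n + 1 < digitSum a (t + 1) ∧ digitSum a t ≤ n + 1 := by
    refine ⟨Nat.find hex, Nat.find_spec hex, ?_⟩
    rcases Nat.eq_zero_or_pos (Nat.find hex) with h0 | h0
    · rw [h0]; simp [digitSum]
    · have := Nat.find_min hex (show Nat.find hex - 1 < Nat.find hex by omega)
      rw [Nat.sub_add_cancel h0] at this
      omega
  have htT : T ≤ t := by
    by_contra hlt
    have := digitSum_mono a (show t + 1 ≤ T + 1 by omega)
    omega
  obtain ⟨b, hb⟩ := Nat.exists_eq_add_of_le ht2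
  rw [digitSum_succ] at ht1
  obtain ⟨s, h1, h2, h3⟩ := h.exists_adj (t := t) (b := b) (by omega) (by omega)
  rw [show digitSum a t + b - 1 = n by omega] at h1
  refine ⟨s, _, _, h1, h2, h3, ?_⟩
  have h4 := (hT t htT).le
  have h5 : (convDen a t : ℝ) ≤ convDen a (t + 1) := by exact_mod_cast convDen_le_succ h.one_le t
  have h6 : (((convergent a (t + 1)).2 : ℕ) : ℝ) = convDen a (t + 1) := rfl
  have h7 : (((convergent a t + b • convergent a (t + 1)).2 : ℕ) : ℝ) =
      convDen a t + b * convDen a (t + 1) := by simp [convDen]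
  rw [h6, h7]
  set q : ℝ := (convDen a (t + 1) : ℝ) with hq
  have hq2 : q ^ 2 ≤ denNormSq a t := by
    unfold denNormSq
    linarith [sq_nonneg (convDen a t : ℝ)]
  have hq0 : 0 ≤ q := by positivity
  have h8 : (q + (convDen a t + b * q)) ^ 2 ≤ ((b + 2) * q) ^ 2 := by
    gcongr
    linarith
  have h9 := add_two_sq_le b
  have hn2 : (2 : ℝ) ^ n * 2 = 2 ^ digitSum a t * 2 ^ b := by
    rw [← pow_succ, hb, pow_add]
  rw [div_le_iff₀ (by positivity)] at h4 ⊢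
  have h10 : ((b + 2) * q) ^ 2 ≤ (9 * 2 ^ b) * (ε / 18 * 2 ^ digitSum a t) := by
    rw [mul_pow]
    gcongr
    exact hq2.trans h4
  calc _ ≤ _ := h8
    _ ≤ _ := h10
    _ = ε / 2 * (2 ^ digitSum a t * 2 ^ b) := by ring
    _ = _ := by rw [← hn2]; ring

/-! ### Construction of a point without derivative. -/

lemma denNormSq_const_block_le {a : ℕ → ℕ} {T c n : ℕ}
    (h : ∀ t, T ≤ t → t < T + n → a t = c) :
    denNormSq a (T + n) ≤ (lambdaConst c ^ 2) ^ n * denNormSq a T := by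
  induction n with
  | zero => simp
  | succ n ih =>
    have h1 := ih fun t h1 h2 => h t h1 (by omega)
    have h2 := denNormSq_succ_le a (T + n)
    rw [h (T + n) (by omega) (by omega)] at h2
    calc denNormSq a (T + n + 1) ≤ _ := h2
      _ ≤ lambdaConst c ^ 2 * ((lambdaConst c ^ 2) ^ n * denNormSq a T) := by gcongr
      _ = _ := by rw [pow_succ (lambdaConst c ^ 2)]; ring

/-- Pairing the denominators with the eigenvector (λ_c, 1) gives a quantity multiplied by exactly
λ_c at each step. Comparing it with a single denominator costs the factor 2. -/
lemma pow_mul_convDen_le_const_block {a : ℕ → ℕ} (ha : ∀ i, 1 ≤ a i) {T c n : ℕ}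
    (h : ∀ t, T ≤ t → t < T + n → a t = c) :
    lambdaConst c ^ n * convDen a (T + 1) ≤ 2 * convDen a (T + n + 1) := by
  have hl := one_le_lambdaConst c
  have hl2 := lambdaConst_sq c
  have key : lambdaConst c ^ n * (lambdaConst c * convDen a (T + 1) + convDen a T) =
      lambdaConst c * convDen a (T + n + 1) + convDen a (T + n) := by
    induction n with
    | zero => simp
    | succ n ih =>
      have h1 := ih fun t h1 h2 => h t h1 (by omega)
      rw [show T + (n + 1) + 1 = T + n + 2 by ring, convDen_succ_succ,
        h (T + n) (by omega) (by omega), pow_succ]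
      push_cast
      rw [← add_assoc]
      linear_combination lambdaConst c * h1 + (convDen a (T + n + 1) : ℝ) * hl2
  have h1 : (convDen a (T + n) : ℝ) ≤ convDen a (T + n + 1) := by
    exact_mod_cast convDen_le_succ ha _
  have h2 : lambdaConst c * (lambdaConst c ^ n * convDen a (T + 1)) ≤
      lambdaConst c * (2 * convDen a (T + n + 1)) := by
    have h3 : (0 : ℝ) ≤ lambdaConst c ^ n * convDen a T := by positivity
    have h4 : (0 : ℝ) ≤ convDen a (T + n + 1) := by positivity
    nlinarith
  exact le_of_mul_le_mul_left h2 (by linarith)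

lemma one_le_convDen_succ {a : ℕ → ℕ} (ha : ∀ i, 1 ≤ a i) (t : ℕ) : 1 ≤ convDen a (t + 1) := by
  induction t with
  | zero => simp [convDen, convergent]
  | succ t ih => exact ih.trans (convDen_le_succ ha _)

lemma convDen_succ_le_mul {a : ℕ → ℕ} (ha : ∀ i, 1 ≤ a i) {t c : ℕ} (h : a t ≤ c) :
    convDen a (t + 2) ≤ (c + 1) * convDen a (t + 1) := by
  rw [convDen_succ_succ]
  have := convDen_le_succ ha t
  nlinarith

lemma convergent_congr {a a' : ℕ → ℕ} {t : ℕ} (h : ∀ i < t, a i = a' i) :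
    convergent a t = convergent a' t ∧ convergent a (t + 1) = convergent a' (t + 1) := by
  induction t with
  | zero => exact ⟨rfl, rfl⟩
  | succ t ih =>
    obtain ⟨h1, h2⟩ := ih fun i hi => h i (by omega)
    refine ⟨h2, ?_⟩
    simp only [convergent]
    rw [h1, h2, h t (by omega)]

lemma digitSum_congr {a a' : ℕ → ℕ} {t : ℕ} (h : ∀ i < t, a i = a' i) :
    digitSum a t = digitSum a' t :=
  Finset.sum_congr rfl fun i hi => h i (Finset.mem_range.1 hi)

/-- The slope of `?` over the Stern–Brocot interval between the convergents of orders `t - 1`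
and `t`. -/
noncomputable def convSlope (a : ℕ → ℕ) (t : ℕ) : ℝ :=
  (convDen a (t + 1) : ℝ) * convDen a t * 2 / 2 ^ digitSum a t

lemma convSlope_congr {a a' : ℕ → ℕ} {t : ℕ} (h : ∀ i < t, a i = a' i) :
    convSlope a t = convSlope a' t := by
  unfold convSlope convDen
  rw [(convergent_congr h).1, (convergent_congr h).2, digitSum_congr h]

lemma IsContFracTails.exists_adj_convSlope {a : ℕ → ℕ} {X : ℕ → ℝ} (h : IsContFracTails a X)
    {t : ℕ} (ht : 1 ≤ t) :
    ∃ n, t ≤ n + 1 ∧ ∃ s u v, SBAdj s n u v ∧ 0 < s * (X 0 - fracVal u) ∧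
      0 < s * (fracVal v - X 0) ∧ (u.2 : ℝ) * v.2 / 2 ^ n = convSlope a t := by
  have h1 := digitSum_ge h.one_le t
  obtain ⟨s, h2, h3, h4⟩ := h.exists_adj (t := t) (b := 0) (Nat.zero_le _) (by omega)
  simp only [zero_smul, add_zero] at h2 h4
  obtain ⟨n, hn⟩ : ∃ n, digitSum a t = n + 1 := ⟨digitSum a t - 1, by omega⟩
  rw [hn] at h2
  refine ⟨n, by omega, s, _, _, h2, h3, h4, ?_⟩
  unfold convSlope convDen
  rw [hn, pow_succ]
  field_simp

/-- A block `5, …, 5, 4, …, 4` can be appended so that the slope of `?` drops below `1 / 2` and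
returns above `1`, while the sum of the partial quotients stays above `κ₂ t - ψ t`. -/
lemma exists_extension {ψ : ℕ → ℝ} (hψ : MonotoneOn ψ (Set.Ici 1)) (hψ' : Tendsto ψ atTop atTop)
    {a : ℕ → ℕ} (ha : ∀ i, 1 ≤ a i) {T : ℕ} (hT : 1 ≤ T)
    (hS : ∀ t, 1 ≤ t → t ≤ T → kappaTwo * t - ψ t ≤ digitSum a t) :
    ∃ (a' : ℕ → ℕ) (T' m : ℕ), (∀ i, 1 ≤ a' i) ∧ T < T' ∧ T ≤ m ∧ m ≤ T' ∧
      (∀ i < T, a' i = a i) ∧ (∀ t, 1 ≤ t → t ≤ T' → kappaTwo * t - ψ t ≤ digitSum a' t) ∧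
      convSlope a' m ≤ 1 / 2 ∧ 1 ≤ convSlope a' T' := by
  have hD := kappaDen_pos
  have hk4 := four_lt_kappaTwo
  have hk5 := kappaTwo_lt_five
  have hl4 := lambdaConst_pos 4
  have hl5 := lambdaConst_pos 5
  -- The final slope is 2Qq/2^S with q ≥ Q/6 and Q ≥ λ₄^B λ₅ⁿ/4, hence the constant 48 = 3 · 16. `M`
  -- depends only on the given prefix.
  set M : ℝ := Real.log (48 * 2 ^ digitSum a T) with hM
  have hM0 : 0 ≤ M := Real.log_nonneg (by
    have : (1 : ℝ) ≤ 2 ^ digitSum a T := one_le_pow₀ (by norm_num)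
    linarith)
  -- The length of the block of 5s. The bound asked of ψ dominates the deficit at the end of the 4s
  -- and does not involve n.
  obtain ⟨n, hn1, hnψ, hnsmall⟩ : ∃ n : ℕ, 1 ≤ n ∧
      kappaTwo * T + M / (2 * kappaDen) + (kappaTwo - 4) ≤ ψ (n + T) ∧
      (lambdaConst 5 ^ 2 / 32) ^ n * (2 * denNormSq a T / 2 ^ digitSum a T) < 1 / 2 := by
    have e1 := ((hψ'.comp (tendsto_add_atTop_nat T)).eventually_ge_atTop
      (kappaTwo * T + M / (2 * kappaDen) + (kappaTwo - 4)))
    have hq : lambdaConst 5 ^ 2 / 32 < 1 := by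
      rw [div_lt_one (by norm_num)]
      nlinarith [lambdaConst_five_bounds.2]
    have e2 := (tendsto_pow_atTop_nhds_zero_of_lt_one (by positivity) hq).mul_const
      (2 * denNormSq a T / 2 ^ digitSum a T)
    rw [zero_mul] at e2
    have e3 := e2.eventually (gt_mem_nhds (show (0 : ℝ) < 1 / 2 by norm_num))
    obtain ⟨n, h1, h2, h3⟩ := ((eventually_ge_atTop 1).and (e1.and e3)).exists
    exact ⟨n, h1, h2, h3⟩
  -- The real number of 4s that offsets the n digits 5 and gains the factor e^M; rounding up to `B`
  -- costs at most κ₂ - 4 more in the deficit.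
  set A : ℝ := (M + 2 * kappaDen * (n * (5 - kappaTwo))) / (2 * kappaDen * (kappaTwo - 4)) with hA
  have hA0 : 0 ≤ A := by
    have : 0 < kappaTwo - 4 := by linarith
    have : 0 < 5 - kappaTwo := by linarith
    positivity
  set B : ℕ := ⌈A⌉₊
  have hB1 : A ≤ B := Nat.le_ceil A
  have hB2 : (B : ℝ) < A + 1 := Nat.ceil_lt_add_one hA0
  have hA2 : A * (kappaTwo - 4) = M / (2 * kappaDen) + n * (5 - kappaTwo) := by
    have : kappaTwo - 4 ≠ 0 := by linarith
    rw [hA]; field_simp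
  let a' : ℕ → ℕ := fun i => if i < T then a i else if i < T + n then 5 else 4
  have ha' : ∀ i, 1 ≤ a' i := by
    intro i
    simp only [a']
    split_ifs
    · exact ha i
    · norm_num
    · norm_num
  have hold : ∀ i < T, a' i = a i := fun i hi => by simp only [a', if_pos hi]
  have h5 : ∀ t, T ≤ t → t < T + n → a' t = 5 := fun t h1 h2 => by
    simp only [a', if_neg (not_lt.2 h1), if_pos h2]
  have h4 : ∀ t, T + n ≤ t → a' t = 4 := fun t h1 => by
    simp only [a', if_neg (not_lt.2 (show T ≤ t by omega)), if_neg (not_lt.2 h1)]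
  have hST : digitSum a' T = digitSum a T := digitSum_congr hold
  have hS5 : ∀ i ≤ n, digitSum a' (T + i) = digitSum a T + 5 * i := fun i hi => by
    rw [digitSum_const_block fun t h1 h2 => h5 t h1 (by omega), hST]
  have hS4 : ∀ j, digitSum a' (T + n + j) = digitSum a T + 5 * n + 4 * j := fun j => by
    rw [digitSum_const_block fun t h1 _ => h4 t h1, hS5 n le_rfl]
  refine ⟨a', T + n + B, T + n, ha', by omega, by omega, by omega, hold, ?_, ?_, ?_⟩
  · intro t ht1 htT
    rcases le_total t T with h | h
    · rw [digitSum_congr fun i hi => hold i (by omega)]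
      exact hS t ht1 h
    obtain ⟨i, rfl⟩ := Nat.exists_eq_add_of_le h
    rcases le_total i n with hi | hi
    · rw [hS5 i hi]
      -- Along the 5s, S_t - κ₂t increases because κ₂ < 5, so the bound at T persists.
      have h1 := hS T hT le_rfl
      have h2 : ψ T ≤ ψ (T + i) := hψ (Set.mem_Ici.2 hT) (Set.mem_Ici.2 ht1) h
      push_cast
      have h3 : (0 : ℝ) ≤ i := by positivity
      nlinarith
    · obtain ⟨j, rfl⟩ := Nat.exists_eq_add_of_le hi
      rw [← add_assoc] at htT ht1 ⊢
      rw [hS4 j]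
      have h2 : ψ (n + T) ≤ ψ (T + n + j) :=
        hψ (Set.mem_Ici.2 (by omega)) (Set.mem_Ici.2 ht1) (by omega)
      have hj : (j : ℝ) ≤ B := by exact_mod_cast (show j ≤ B by omega)
      have h3 : (j : ℝ) * (kappaTwo - 4) ≤ (A + 1) * (kappaTwo - 4) :=
        mul_le_mul_of_nonneg_right (by linarith) (by linarith)
      push_cast
      have h6 : (0 : ℝ) ≤ digitSum a T := by positivity
      linarith
  · have h1 := denNormSq_const_block_le h5
    have h2 : denNormSq a' T = denNormSq a T := by
      unfold denNormSq convDen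
      rw [(convergent_congr hold).1, (convergent_congr hold).2]
    have h3 : (convDen a' (T + n) : ℝ) ≤ convDen a' (T + n + 1) := by
      exact_mod_cast convDen_le_succ ha' _
    have h6 : (convDen a' (T + n + 1) : ℝ) * convDen a' (T + n) ≤ denNormSq a' (T + n) := by
      unfold denNormSq
      nlinarith [sq_nonneg (convDen a' (T + n) : ℝ)]
    unfold convSlope
    rw [hS5 n le_rfl, pow_add, pow_mul, show (2 : ℝ) ^ 5 = 32 by norm_num]
    rw [h2] at h1
    refine le_trans ?_ hnsmall.le
    rw [div_pow, div_mul_div_comm, mul_comm ((32 : ℝ) ^ n)]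
    gcongr ?_ / _
    linarith
  · have hb5 := pow_mul_convDen_le_const_block ha' h5
    have hb4 := pow_mul_convDen_le_const_block ha' (T := T + n) (n := B) (c := 4)
      fun t h1 _ => h4 t h1
    have hq0 : (1 : ℝ) ≤ convDen a' (T + 1) := by exact_mod_cast one_le_convDen_succ ha' T
    have hlow : lambdaConst 4 ^ B * lambdaConst 5 ^ n ≤ 4 * convDen a' (T + n + B + 1) := by
      have h1 : lambdaConst 5 ^ n ≤ 2 * convDen a' (T + n + 1) :=
        (le_mul_of_one_le_right (by positivity) hq0).trans hb5
      have h2 : lambdaConst 4 ^ B * lambdaConst 5 ^ n ≤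
          lambdaConst 4 ^ B * (2 * convDen a' (T + n + 1)) := by gcongr
      linarith
    have hlast : (convDen a' (T + n + B + 1) : ℝ) ≤ 6 * convDen a' (T + n + B) := by
      obtain ⟨k, hk⟩ : ∃ k, T + n + B = k + 1 := ⟨T + n + B - 1, by omega⟩
      rw [hk]
      have h1 : a' k ≤ 5 := by
        rcases lt_or_ge k (T + n) with h | h
        · rw [h5 k (by omega) h]
        · rw [h4 k h]; norm_num
      exact_mod_cast convDen_succ_le_mul ha' h1
    have hexp : Real.exp (2 * kappaDen * (B * (kappaTwo - 4) - n * (5 - kappaTwo))) =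
        (lambdaConst 4 ^ B * lambdaConst 5 ^ n) ^ 2 / (32 ^ n * 16 ^ B) := by
      have h1 := digitWeight_eq_exp 4
      have h2 := digitWeight_eq_exp 5
      rw [digitWeight_four] at h1
      rw [digitWeight_five] at h2
      rw [show 2 * kappaDen * (B * (kappaTwo - 4) - n * (5 - kappaTwo)) =
        -(B * (2 * kappaDen * ((4 : ℕ) - kappaTwo)) + n * (2 * kappaDen * ((5 : ℕ) - kappaTwo))) by
        push_cast; ring, Real.exp_neg, Real.exp_add, Real.exp_nat_mul, Real.exp_nat_mul, ← h1, ← h2]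
      norm_num
      simp only [mul_pow, inv_pow]
      field_simp
      ring
    have hge : (48 : ℝ) * 2 ^ digitSum a T ≤
        (lambdaConst 4 ^ B * lambdaConst 5 ^ n) ^ 2 / (32 ^ n * 16 ^ B) := by
      rw [← hexp, ← Real.exp_log (show (0 : ℝ) < 48 * 2 ^ digitSum a T by positivity), ← hM]
      apply Real.exp_le_exp.2
      have h1 : A * (kappaTwo - 4) ≤ B * (kappaTwo - 4) :=
        mul_le_mul_of_nonneg_right hB1 (by linarith)
      rw [hA2] at h1
      have h2 : M / (2 * kappaDen) ≤ B * (kappaTwo - 4) - n * (5 - kappaTwo) := by linarith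
      rw [div_le_iff₀ (by linarith)] at h2
      linarith
    rw [le_div_iff₀ (by positivity)] at hge
    unfold convSlope
    rw [one_le_div (by positivity), hS4 B, pow_add, pow_add, pow_mul, pow_mul,
      show (2 : ℝ) ^ 5 = 32 by norm_num, show (2 : ℝ) ^ 4 = 16 by norm_num]
    set Q : ℝ := (convDen a' (T + n + B + 1) : ℝ)
    have h1 : (lambdaConst 4 ^ B * lambdaConst 5 ^ n) ^ 2 ≤ (4 * Q) ^ 2 := by gcongr
    have h2 : 0 ≤ Q := by positivity
    nlinarith

/-- Iterate `exists_extension`. Each stage keeps the previous prefix, and both digit sums and slopes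
depend only on a prefix, so they pass to the limit sequence. -/
lemma exists_digits {ψ : ℕ → ℝ} (hψ : MonotoneOn ψ (Set.Ici 1)) (hψ' : Tendsto ψ atTop atTop) :
    ∃ a : ℕ → ℕ, (∀ i, 1 ≤ a i) ∧ (∀ t, 1 ≤ t → kappaTwo * t - ψ t ≤ digitSum a t) ∧
      (∀ N, ∃ t ≥ N, convSlope a t ≤ 1 / 2) ∧ ∀ N, ∃ t ≥ N, 1 ≤ convSlope a t := by
  let P : (ℕ → ℕ) × ℕ → Prop := fun p => (∀ i, 1 ≤ p.1 i) ∧ 1 ≤ p.2 ∧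
    ∀ t, 1 ≤ t → t ≤ p.2 → kappaTwo * t - ψ t ≤ digitSum p.1 t
  have hstep : ∀ p : {p // P p}, ∃ p' : {p // P p}, p.1.2 < p'.1.2 ∧
      (∀ i < p.1.2, p'.1.1 i = p.1.1 i) ∧
      (∃ m, p.1.2 ≤ m ∧ m ≤ p'.1.2 ∧ convSlope p'.1.1 m ≤ 1 / 2) ∧
      1 ≤ convSlope p'.1.1 p'.1.2 := by
    rintro ⟨⟨a, T⟩, ha, hT, hS⟩
    obtain ⟨a', T', m, h1, h2, h3, h4, h5, h6, h7, h8⟩ := exists_extension hψ hψ' ha hT hS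
    exact ⟨⟨⟨a', T'⟩, h1, by simp only; omega, h6⟩, h2, h5, ⟨m, h3, h4, h7⟩, h8⟩
  choose f hf1 hf2 hf3 hf4 using hstep
  -- A large first digit secures the condition at t = 1, whatever the value ψ(1).
  have h0 : P (fun _ => ⌈kappaTwo - ψ 1⌉₊ + 1, 1) := by
    refine ⟨fun i => by simp, le_rfl, fun t h1 h2 => ?_⟩
    obtain rfl : t = 1 := le_antisymm h2 h1
    have := Nat.le_ceil (kappaTwo - ψ 1)
    simp only [digitSum, Finset.sum_range_one]
    push_cast
    linarith
  let st : ℕ → {p // P p} := fun k => f^[k] ⟨_, h0⟩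
  have hst : ∀ k, st (k + 1) = f (st k) := fun k => Function.iterate_succ_apply' f k _
  have hT1 : ∀ k, k + 1 ≤ (st k).1.2 := by
    intro k
    induction k with
    | zero => exact (st 0).2.2.1
    | succ k ih => have := hf1 (st k); rw [hst]; omega
  have hTm : Monotone fun k => (st k).1.2 :=
    monotone_nat_of_le_succ fun k => by rw [hst]; exact (hf1 _).le
  have hagree : ∀ k d i, i < (st k).1.2 → (st (k + d)).1.1 i = (st k).1.1 i := by
    intro k d i hi
    induction d with
    | zero => rfl
    | succ d ih =>
      rw [← add_assoc, hst, hf2 _ i (lt_of_lt_of_le hi (hTm (Nat.le_add_right k d))), ih]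
  -- Diagonal choice: stage i has already fixed at least i + 1 digits.
  let a : ℕ → ℕ := fun i => (st i).1.1 i
  have ha : ∀ k i, i < (st k).1.2 → a i = (st k).1.1 i := by
    intro k i hi
    rcases le_total k i with h | h
    · obtain ⟨d, rfl⟩ := Nat.exists_eq_add_of_le h
      exact hagree k d _ hi
    · obtain ⟨d, rfl⟩ := Nat.exists_eq_add_of_le h
      exact (hagree i d i (hT1 i)).symm
  refine ⟨a, fun i => (st i).2.1 i, fun t ht => ?_, fun N => ?_, fun N => ?_⟩
  · have h1 := hT1 t
    rw [digitSum_congr fun i hi => ha t i (by omega)]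
    exact (st t).2.2.2 t ht (by omega)
  · obtain ⟨m, h1, h2, h3⟩ := hf3 (st N)
    have h4 := hT1 N
    refine ⟨m, by omega, ?_⟩
    rw [← hst] at h2 h3
    rwa [convSlope_congr fun i hi => ha (N + 1) i (by omega)]
  · have h1 := hf4 (st N)
    have h4 := hT1 (N + 1)
    rw [← hst] at h1
    refine ⟨(st (N + 1)).1.2, by omega, ?_⟩
    rwa [convSlope_congr fun i hi => ha (N + 1) i hi]

theorem exists_not_hasFiniteOrInfiniteDerivAt {ψ : ℕ → ℝ} (hψ : MonotoneOn ψ (Set.Ici 1))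
    (hψ' : Tendsto ψ atTop atTop) :
    ∃ x : ℝ, x ∈ Set.Ioo (0 : ℝ) 1 ∧ Irrational x ∧
      ¬ HasFiniteOrInfiniteDerivAt minkowskiQuestionMark x ∧
      ∀ t : ℕ, 1 ≤ t → kappaTwo * (t : ℝ) - ψ t ≤ partialQuotientSum x t := by
  obtain ⟨a, ha, hS, hlow, hhigh⟩ := exists_digits hψ hψ'
  obtain ⟨X, hX⟩ := exists_isContFracTails ha
  refine ⟨X 0, ⟨(hX 0).1, (hX 0).2.1⟩, hX.irrational, ?_, ?_⟩
  · apply not_hasFiniteOrInfiniteDerivAt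
    · intro N
      obtain ⟨t, ht, h1⟩ := hhigh (N + 1)
      obtain ⟨n, hn, s, u, v, h2, h3, h4, h5⟩ := hX.exists_adj_convSlope (t := t) (by omega)
      exact ⟨n, by omega, s, u, v, h2, h3, h4, h5 ▸ h1⟩
    · intro N
      obtain ⟨t, ht, h1⟩ := hlow (N + 1)
      obtain ⟨n, hn, s, u, v, h2, h3, h4, h5⟩ := hX.exists_adj_convSlope (t := t) (by omega)
      exact ⟨n, by omega, s, u, v, h2, h3, h4, h5 ▸ h1⟩
  · intro t ht
    rw [hX.partialQuotientSum_eq]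
    exact hS t ht

theorem theorem3 :
    (∀ x : ℝ, x ∈ Set.Ioo (0 : ℝ) 1 → Irrational x →
      (∃ C : ℝ, ∀ t : ℕ, 1 ≤ t → kappaTwo * (t : ℝ) - C ≤ partialQuotientSum x t) →
        HasDerivAt minkowskiQuestionMark 0 x) ∧
    (∀ ψ : ℕ → ℝ, MonotoneOn ψ (Set.Ici 1) → Tendsto ψ atTop atTop →
      ∃ x : ℝ, x ∈ Set.Ioo (0 : ℝ) 1 ∧ Irrational x ∧
        ¬ HasFiniteOrInfiniteDerivAt minkowskiQuestionMark x ∧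
        ∀ t : ℕ, 1 ≤ t → kappaTwo * (t : ℝ) - ψ t ≤ partialQuotientSum x t) :=
  ⟨fun _ hx hirr ⟨_, hC⟩ => hasDerivAt_minkowskiQuestionMark_zero hx hirr hC,
    fun _ hψ hψ' => exists_not_hasFiniteOrInfiniteDerivAt hψ hψ'⟩
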